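/- Let $X_0, X_1$ be Banach spaces with $X_1$ continuously and densely embedded in $X_0$, let $1<p<\infty$ and $\mu\in(1/p,1]$. Write $\mathbb R_+=(0,\infty)$. For a Banach space $X$ let $L_{p,\mu}(\mathbb R_+;X)$ be the space of (classes of) strongly measurable $f:\mathbb R_+\to X$ with $\|f\|_{L_{p,\mu}}=\big(\int_0^\infty \|t^{1-\mu}f(t)\|^p\,dt\big)^{1/p}<\infty$, and let $W^1_{p,\mu}(\mathbb R_+;X)$ be the space of all $u\in L_{p,\mu}(\mathbb R_+;X)\cap W^1_{1,loc}(\mathbb R_+;X)$ with weak derivative $\dot u\in L_{p,\mu}(\mathbb R_+;X)$, with norm $\big(\|u\|_{L_{p,\mu}}^p+\|\dot u\|_{L_{p,\mu}}^p\big)^{1/p}$. Put $$\mathbb E_{1,\mu}=W^1_{p,\mu}(\mathbb R_+;X_0)\cap L_{p,\mu}(\mathbb R_+;X_1),\qquad \|u\|_{\mathbb E_{1,\mu}}=\|u\|_{W^1_{p,\mu}(\mathbb R_+;X_0)}+\|u\|_{L_{p,\mu}(\mathbb R_+;X_1)}.$$ Elements $u$ of $\mathbb E_{1,\mu}$ are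 identified with their representative that is continuous on $[0,\infty)$ with values in $X_0$. Let $\operatorname{tr}u=u(0)$, and let $\operatorname{tr}\mathbb E_{1,\mu}=\{u(0):u\in\mathbb E_{1,\mu}\}\subset X_0$ be equipped with the norm $\|x\|_{\operatorname{tr}}=\inf\{\|u\|_{\mathbb E_{1,\mu}}:u\in\mathbb E_{1,\mu},\ u(0)=x\}$. For $0<\theta<1$ let $(X_0,X_1)_{\theta,p}$ be the real interpolation space of all $x\in X_0$ with $$\|x\|_{\theta,p}=\Big(\int_0^\infty\big(t^{-\theta}K(t,x)\big)^p\,\frac{dt}{t}\Big)^{1/p}<\infty,\qquad K(t,x)=\inf\{\|a\|_{X_0}+t\|b\|_{X_1}: a\in X_0,\ b\in X_1,\ a+b=x\}.$$ Then $$\operatorname{tr}\mathbb E_{1,\mu}=(X_0,X_1)_{\mu-1/p,p}$$ with equivalent norms. Moreover, there is a continuous embedding $$\mathbb E_{1,\mu}\hookrightarrow BUC\big([0,\infty);(X_0,X_1)_{\mu-1/p,p}\big),$$ that is, every $u\in\mathbb E_{1,\mu}$ is (after modification on a null set) a bounded, uniformly continuous function on $[0,\infty)$ with values in $(X_0,X_1)_{\mu-1/p,p}$,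 and $\sup_{t\ge0}\|u(t)\|_{\mu-1/p,p}\le C\|u\|_{\mathbb E_{1,\mu}}$ with a constant $C$ independent of $u$. -/

import Mathlib

open Set MeasureTheory
open scoped ENNReal NNReal ContDiff

noncomputable section

namespace TimeWeight

section Spaces

variable {X : Type*} [NormedAddCommGroup X] [NormedSpace ℝ X]

/-- `f ∈ L_{p,μ}(ℝ₊; X)`, i.e. `t ↦ t^(1-μ) f(t)` belongs to `L_p((0,∞); X)`. Only the values of
`f` on `(0,∞)` matter, up to null sets. -/
def MemWLp (p μ : ℝ) (f : ℝ → X) : Prop :=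
  MemLp (fun t : ℝ => t ^ (1 - μ) • f t) (ENNReal.ofReal p) (volume.restrict (Ioi 0))

/-- The norm `(∫₀^∞ |t^(1-μ) f(t)|^p dt)^(1/p)` of `L_{p,μ}(ℝ₊; X)`. -/
def wLpNorm (p μ : ℝ) (f : ℝ → X) : ℝ≥0∞ :=
  eLpNorm (fun t : ℝ => t ^ (1 - μ) • f t) (ENNReal.ofReal p) (volume.restrict (Ioi 0))

/-- `v ∈ L_{1,loc}(ℝ₊; X)` is a weak derivative of `u ∈ L_{1,loc}(ℝ₊; X)` on `ℝ₊ = (0,∞)`. -/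
structure HasWeakDeriv (u v : ℝ → X) : Prop where
  locallyIntegrable : LocallyIntegrableOn u (Ioi 0) volume
  locallyIntegrable_deriv : LocallyIntegrableOn v (Ioi 0) volume
  integral_eq : ∀ φ : ℝ → ℝ, ContDiff ℝ ∞ φ → HasCompactSupport φ → tsupport φ ⊆ Ioi 0 →
    ∫ t in Ioi (0 : ℝ), deriv φ t • u t = - ∫ t in Ioi (0 : ℝ), φ t • v t

/-- `u ∈ W¹_{1,loc}(ℝ₊; X)`. -/
def MemW1loc (u : ℝ → X) : Prop := ∃ v : ℝ → X, HasWeakDeriv u v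

open Classical in
/-- The weak derivative of `u ∈ W¹_{1,loc}(ℝ₊; X)`, which is unique up to null sets
(zero if there is none). -/
def weakDeriv (u : ℝ → X) : ℝ → X :=
  if h : ∃ v : ℝ → X, HasWeakDeriv u v then h.choose else 0

/-- `u ∈ W¹_{p,μ}(ℝ₊; X)`. -/
structure MemW (p μ : ℝ) (u : ℝ → X) : Prop where
  memWLp : MemWLp p μ u
  memW1loc : MemW1loc u
  memWLp_deriv : MemWLp p μ (weakDeriv u)

/-- The norm of `W¹_{p,μ}(ℝ₊; X)`. -/
def wNorm (p μ : ℝ) (u : ℝ → X) : ℝ≥0∞ :=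
  (wLpNorm p μ u ^ p + wLpNorm p μ (weakDeriv u) ^ p) ^ (1 / p)

/-- `x = u(0)`, where `u` is identified with its (unique) representative that is continuous on
`[0,∞)`. -/
def IsTrace (u : ℝ → X) (x : X) : Prop :=
  ∃ v : ℝ → X, v =ᵐ[volume.restrict (Ioi 0)] u ∧ ContinuousOn v (Ici 0) ∧ v 0 = x

end Spaces

section Couple

variable {X₀ X₁ : Type*} [NormedAddCommGroup X₀] [NormedSpace ℝ X₀]
  [NormedAddCommGroup X₁] [NormedSpace ℝ X₁]

/-- `u ∈ W¹_{p,μ}(ℝ₊; X₀) ∩ L_{p,μ}(ℝ₊; X₁)`, where `X₁ ↪ X₀` through `ι`: an element of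
`L_{p,μ}(ℝ₊; X₁)` which, as an `X₀`-valued function, belongs to `W¹_{p,μ}(ℝ₊; X₀)`. -/
structure MemE (ι : X₁ →L[ℝ] X₀) (p μ : ℝ) (u : ℝ → X₁) : Prop where
  memWLp : MemWLp p μ u
  memW : MemW p μ (fun t => ι (u t))

/-- The norm of the intersection `W¹_{p,μ}(ℝ₊; X₀) ∩ L_{p,μ}(ℝ₊; X₁)`. -/
def eNorm (ι : X₁ →L[ℝ] X₀) (p μ : ℝ) (u : ℝ → X₁) : ℝ≥0∞ :=
  wNorm p μ (fun t => ι (u t)) + wLpNorm p μ u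

/-- The trace space `tr 𝔼_{1,μ}`. -/
def traceSpace (ι : X₁ →L[ℝ] X₀) (p μ : ℝ) : Set X₀ :=
  {x | ∃ u : ℝ → X₁, MemE ι p μ u ∧ IsTrace (fun t => ι (u t)) x}

/-- The quotient norm `inf {‖u‖ : u ∈ 𝔼_{1,μ}, u(0) = x}` of the trace space
(infinite outside the trace space). -/
def traceNorm (ι : X₁ →L[ℝ] X₀) (p μ : ℝ) (x : X₀) : ℝ≥0∞ :=
  ⨅ (u : ℝ → X₁) (_ : MemE ι p μ u) (_ : IsTrace (fun t => ι (u t)) x), eNorm ι p μ u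

/-- Peetre's `K`-functional `K(t, x) = inf {‖a‖ + t ‖b‖ : a ∈ X₀, b ∈ X₁, a + b = x}`, `t > 0`.
Here `X₀ + X₁ = X₀`. -/
def kFunctional (ι : X₁ →L[ℝ] X₀) (t : ℝ) (x : X₀) : ℝ≥0∞ :=
  ⨅ (a : X₀) (b : X₁) (_ : a + ι b = x), ‖a‖ₑ + ENNReal.ofReal t * ‖b‖ₑ

/-- The norm `(∫₀^∞ (t^(-θ) K(t, x))^p dt/t)^(1/p)` of the real interpolation space
`(X₀, X₁)_{θ,p}` (infinite outside that space). -/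
def interpNorm (ι : X₁ →L[ℝ] X₀) (θ p : ℝ) (x : X₀) : ℝ≥0∞ :=
  (∫⁻ t in Ioi (0 : ℝ),
    (ENNReal.ofReal (t ^ (-θ)) * kFunctional ι t x) ^ p * ENNReal.ofReal t⁻¹) ^ (1 / p)

/-- The real interpolation space `(X₀, X₁)_{θ,p}`. -/
def interpSpace (ι : X₁ →L[ℝ] X₀) (θ p : ℝ) : Set X₀ :=
  {x | interpNorm ι θ p x < ⊤}

/-- `v ∈ BUC([0,∞); (X₀, X₁)_{θ,p})`. -/
structure IsBUC (ι : X₁ →L[ℝ] X₀) (θ p : ℝ) (v : ℝ → X₀) : Prop where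
  mem : ∀ t, 0 ≤ t → v t ∈ interpSpace ι θ p
  bounded : ∃ M : ℝ≥0, ∀ t, 0 ≤ t → interpNorm ι θ p (v t) ≤ M
  uniformlyContinuous : ∀ ε : ℝ≥0, 0 < ε → ∃ δ : ℝ, 0 < δ ∧ ∀ s t, 0 ≤ s → 0 ≤ t →
    |s - t| < δ → interpNorm ι θ p (v s - v t) < ε

/-- The supremum norm of `BUC([0,∞); (X₀, X₁)_{θ,p})`. -/
def bucNorm (ι : X₁ →L[ℝ] X₀) (θ p : ℝ) (v : ℝ → X₀) : ℝ≥0∞ :=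
  ⨆ (t : ℝ) (_ : 0 ≤ t), interpNorm ι θ p (v t)

end Couple

end TimeWeight

end

/-! For `u` in the space, the class of `ι ∘ u` is a primitive `x + ∫₀ˢ w` of its weak derivative
`w`, and everything comes from reading this as a splitting `x = -∫₀ˢ w + u(s)` of the initial value
at each `s > 0`. It gives `K(s,x) ≤ ∫₀ˢ ‖w‖ + s‖u(s)‖`. For `θ = μ - 1/p` the interpolation norm is
the `L_p(ds)` norm of `s^(-μ) K(s,x)`. The term `s^(1-μ)‖u(s)‖` then contributes exactly the
weighted norm of `u`, and Hardy's inequality (`exists_hardy_const`), valid because `μ > 1/p`, bounds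
the other term by the weighted norm of `w`. This is the trace estimate `exists_interpNorm_le`.

The BUC embedding is the same estimate applied to translates. Since `μ ≤ 1` the weight is
nondecreasing, so left translation is a contraction, and the bound at time `0` becomes a bound at
every time. Applied to the difference of two translates, it controls increments by `f(· + h) - f`
for `f = u, w`, uniformly in the base point. Strong continuity of translations
(`MemWLp.exists_wLpNorm_comp_add_right_sub_le`) makes this small.

Conversely, for `x` in the interpolation space, choose near-minimizers `b n` for `K(2^n, x)` and
interpolate them affinely in `log t`. With `K = K(t,x)`, the resulting `u` satisfies `‖u(t)‖ ≲ K/t`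
in `X₁`, while in `X₀` both `‖(ιu)'(t)‖ ≲ K/t` and `‖ιu(t) - x‖ ≲ K`. The first two bounds give the
norm estimate, since `t^(1-μ)·t⁻¹ = t^(-μ)`. The last gives `ιu(t) → x`, because `K(t,x) = O(t^θ)`
with `θ > 0`. This is `exists_memE_isTrace`. -/

noncomputable section

namespace TimeWeight

/-! ### Hardy's inequality with power weights. -/

section Hardy

theorem lintegral_Ioc_rpow {b s : ℝ} (hb : -1 < b) (hs : 0 ≤ s) :
    ∫⁻ r in Ioc 0 s, ENNReal.ofReal (r ^ b) = ENNReal.ofReal (s ^ (b + 1) / (b + 1)) := by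
  have hint : IntervalIntegrable (fun r : ℝ => r ^ b) volume 0 s :=
    intervalIntegral.intervalIntegrable_rpow' hb
  rw [← ofReal_integral_eq_lintegral_ofReal
    ((intervalIntegrable_iff_integrableOn_Ioc_of_le hs).1 hint)]
  · rw [← intervalIntegral.integral_of_le hs, integral_rpow (Or.inl hb),
      Real.zero_rpow (by linarith), sub_zero]
  · filter_upwards [ae_restrict_mem measurableSet_Ioc] with r hr
    exact Real.rpow_nonneg hr.1.le _

theorem lintegral_Ici_rpow {b r : ℝ} (hb : b < -1) (hr : 0 < r) :
    ∫⁻ s in Ici r, ENNReal.ofReal (s ^ b) = ENNReal.ofReal (-r ^ (b + 1) / (b + 1)) := by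
  rw [setLIntegral_congr Ioi_ae_eq_Ici.symm,
    ← ofReal_integral_eq_lintegral_ofReal (integrableOn_Ioi_rpow_of_lt hb hr)]
  · rw [integral_Ioi_rpow_of_lt hb hr]
  · filter_upwards [ae_restrict_mem measurableSet_Ioi] with s hs
    exact Real.rpow_nonneg (hr.le.trans (le_of_lt hs)) _

theorem lintegral_Ioi_mul_lintegral_Ioc {k h : ℝ → ℝ≥0∞} (hk : Measurable k)
    (hh : AEMeasurable h (volume.restrict (Ioi 0))) :
    ∫⁻ s in Ioi (0 : ℝ), k s * ∫⁻ r in Ioc 0 s, h r =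
      ∫⁻ r in Ioi (0 : ℝ), h r * ∫⁻ s in Ici r, k s := by
  have hset : MeasurableSet {z : ℝ × ℝ | z.2 ≤ z.1} := measurableSet_le measurable_snd measurable_fst
  have h1 : ∀ s ∈ Ioi (0 : ℝ), k s * ∫⁻ r in Ioc 0 s, h r =
      ∫⁻ r in Ioi (0 : ℝ), {z : ℝ × ℝ | z.2 ≤ z.1}.indicator (fun z => k z.1 * h z.2) (s, r) := by
    intro s _
    have : ∀ r, {z : ℝ × ℝ | z.2 ≤ z.1}.indicator (fun z => k z.1 * h z.2) (s, r) =
        (Iic s).indicator (fun r => k s * h r) r := by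
      intro r; simp [indicator]
    simp_rw [this]
    rw [lintegral_indicator measurableSet_Iic, Measure.restrict_restrict measurableSet_Iic,
      inter_comm, Ioi_inter_Iic, lintegral_const_mul'']
    exact hh.mono_measure (Measure.restrict_mono Ioc_subset_Ioi_self le_rfl)
  have h2 : ∀ r ∈ Ioi (0 : ℝ), h r * ∫⁻ s in Ici r, k s =
      ∫⁻ s in Ioi (0 : ℝ), {z : ℝ × ℝ | z.2 ≤ z.1}.indicator (fun z => k z.1 * h z.2) (s, r) := by
    intro r hr
    have : ∀ s, {z : ℝ × ℝ | z.2 ≤ z.1}.indicator (fun z => k z.1 * h z.2) (s, r) =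
        (Ici r).indicator (fun s => h r * k s) s := by
      intro s; simp [indicator, mul_comm]
    simp_rw [this]
    rw [lintegral_indicator measurableSet_Ici, Measure.restrict_restrict measurableSet_Ici,
      inter_eq_left.2 (Ici_subset_Ioi.2 hr), lintegral_const_mul _ hk]
  rw [setLIntegral_congr_fun measurableSet_Ioi h1, setLIntegral_congr_fun measurableSet_Ioi h2,
    lintegral_lintegral_swap]
  exact ((hk.comp_aemeasurable measurable_fst.aemeasurable).mul
    (hh.comp_quasiMeasurePreserving Measure.quasiMeasurePreserving_snd)).indicator hset

/-- Hardy's inequality with power weights. -/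
theorem exists_hardy_const {p μ : ℝ} (hp : 1 < p) (hμ : 1 / p < μ) :
    ∃ C : ℝ≥0, ∀ g : ℝ → ℝ≥0∞, AEMeasurable g (volume.restrict (Ioi 0)) →
      ∫⁻ s in Ioi (0 : ℝ), (ENNReal.ofReal (s ^ (-μ)) * ∫⁻ r in Ioc 0 s, g r) ^ p ≤
        C * ∫⁻ s in Ioi (0 : ℝ), (ENNReal.ofReal (s ^ (1 - μ)) * g s) ^ p := by
  have hp0 : 0 < p := by linarith
  -- Hölder is applied to `g = r^(-a) · (r^a g)`. The upper bound `a < 1/q` makes `r^(-aq)`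
  -- integrable at `0`; the lower bound `a > 1 - μ` makes the power of `s` left after Tonelli
  -- integrable at infinity.
  obtain ⟨a, ha1, ha2⟩ : ∃ a : ℝ, 1 - μ < a ∧ a < 1 - 1 / p := exists_between (by linarith)
  set q := p.conjExponent with hq
  have hpq : p.HolderConjugate q := Real.HolderConjugate.conjExponent hp
  have hq0 : 0 < q := hpq.symm.pos
  have hqi : 1 / q = 1 - 1 / p := by have := hpq.inv_add_inv_eq_one; simp only [one_div]; linarith
  have haq : -1 < -a * q := by
    have : a * q < 1 := by rw [← hqi, lt_div_iff₀ hq0] at ha2; exact ha2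
    linarith
  have hqp : p / q = p - 1 := by
    rw [div_eq_mul_one_div, hqi]; field_simp
  -- The exponent of `s` after Hölder: `-μp` from the weight, the rest from `(∫₀ˢ r^(-aq)
  -- dr)^(p/q)`.
  set β : ℝ := -μ * p + (-a * q + 1) * (p / q) with hβ
  have hβ1 : β + 1 = -((μ + a - 1) * p) := by
    have : (-a * q + 1) * (p / q) = -a * p + p / q := by field_simp
    rw [hβ, this, hqp]; ring
  have hpos : 0 < (μ + a - 1) * p := mul_pos (by linarith) hp0
  set A : ℝ := (-a * q + 1)⁻¹ ^ (p / q) with hA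
  have hA0 : 0 ≤ A := Real.rpow_nonneg (inv_nonneg.2 (by linarith)) _
  refine ⟨(A * ((μ + a - 1) * p)⁻¹).toNNReal, fun g hg => ?_⟩
  have hw : ∀ b : ℝ, Measurable fun r : ℝ => ENNReal.ofReal (r ^ b) := fun b =>
    (measurable_id.pow_const b).ennreal_ofReal
  have hga : AEMeasurable (fun r => (ENNReal.ofReal (r ^ a) * g r) ^ p)
      (volume.restrict (Ioi 0)) := ((hw a).aemeasurable.mul hg).pow_const p
  have pointwise : ∀ s ∈ Ioi (0 : ℝ),
      (ENNReal.ofReal (s ^ (-μ)) * ∫⁻ r in Ioc 0 s, g r) ^ p ≤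
        ENNReal.ofReal A * (ENNReal.ofReal (s ^ β) *
          ∫⁻ r in Ioc 0 s, (ENNReal.ofReal (r ^ a) * g r) ^ p) := by
    intro s hs
    have hs : 0 < s := hs
    have hle : volume.restrict (Ioc 0 s) ≤ volume.restrict (Ioi (0 : ℝ)) :=
      Measure.restrict_mono Ioc_subset_Ioi_self le_rfl
    have e1 : ∫⁻ r in Ioc 0 s, g r =
        ∫⁻ r in Ioc 0 s, ((fun r => ENNReal.ofReal (r ^ (-a))) *
          fun r => ENNReal.ofReal (r ^ a) * g r) r := by
      refine setLIntegral_congr_fun measurableSet_Ioc fun r hr => ?_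
      simp only [Pi.mul_apply]
      rw [← mul_assoc, ← ENNReal.ofReal_mul (Real.rpow_nonneg hr.1.le _), ← Real.rpow_add hr.1]
      simp
    have e2 := ENNReal.lintegral_mul_le_Lp_mul_Lq (volume.restrict (Ioc 0 s)) hpq.symm
      (hw (-a)).aemeasurable (g := fun r => ENNReal.ofReal (r ^ a) * g r)
      ((hw a).aemeasurable.mul (hg.mono_measure hle))
    rw [← e1] at e2
    have e3 : ∫⁻ r in Ioc 0 s, ENNReal.ofReal (r ^ (-a)) ^ q =
        ENNReal.ofReal (s ^ (-a * q + 1) / (-a * q + 1)) := by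
      rw [← lintegral_Ioc_rpow haq hs.le]
      refine setLIntegral_congr_fun measurableSet_Ioc fun r hr => ?_
      rw [ENNReal.ofReal_rpow_of_nonneg (Real.rpow_nonneg hr.1.le _) hq0.le,
        ← Real.rpow_mul hr.1.le]
    rw [e3] at e2
    calc (ENNReal.ofReal (s ^ (-μ)) * ∫⁻ r in Ioc 0 s, g r) ^ p
        ≤ (ENNReal.ofReal (s ^ (-μ)) * (ENNReal.ofReal (s ^ (-a * q + 1) / (-a * q + 1)) ^ (1 / q) *
            (∫⁻ r in Ioc 0 s, (ENNReal.ofReal (r ^ a) * g r) ^ p) ^ (1 / p))) ^ p := by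
          gcongr
      _ = _ := by
          have hnn : 0 ≤ s ^ (-a * q + 1) / (-a * q + 1) :=
            div_nonneg (Real.rpow_nonneg hs.le _) (by linarith)
          rw [ENNReal.mul_rpow_of_nonneg _ _ hp0.le, ENNReal.mul_rpow_of_nonneg _ _ hp0.le,
            ← ENNReal.rpow_mul, ← ENNReal.rpow_mul, one_div_mul_cancel hp0.ne', ENNReal.rpow_one,
            ENNReal.ofReal_rpow_of_nonneg (Real.rpow_nonneg hs.le _) hp0.le,
            ENNReal.ofReal_rpow_of_nonneg hnn (by positivity), ← mul_assoc, ← mul_assoc,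
            ← ENNReal.ofReal_mul (by positivity), ← ENNReal.ofReal_mul hA0]
          congr 2
          rw [div_eq_mul_inv, Real.mul_rpow (Real.rpow_nonneg hs.le _) (inv_nonneg.2 (by linarith)),
            ← Real.rpow_mul hs.le, ← Real.rpow_mul hs.le, hA, hβ, Real.rpow_add hs,
            show 1 / q * p = p / q by ring]
          ring
  calc _ ≤ ∫⁻ s in Ioi (0 : ℝ), ENNReal.ofReal A * (ENNReal.ofReal (s ^ β) *
          ∫⁻ r in Ioc 0 s, (ENNReal.ofReal (r ^ a) * g r) ^ p) :=
        setLIntegral_mono' measurableSet_Ioi pointwise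
    _ = ENNReal.ofReal A * ∫⁻ r in Ioi (0 : ℝ), (ENNReal.ofReal (r ^ a) * g r) ^ p *
          ∫⁻ s in Ici r, ENNReal.ofReal (s ^ β) := by
        rw [lintegral_const_mul' _ _ ENNReal.ofReal_ne_top, lintegral_Ioi_mul_lintegral_Ioc (hw β) hga]
    _ = ENNReal.ofReal A * ∫⁻ r in Ioi (0 : ℝ), ENNReal.ofReal (((μ + a - 1) * p)⁻¹) *
          (ENNReal.ofReal (r ^ (1 - μ)) * g r) ^ p := by
        congr 1
        refine setLIntegral_congr_fun measurableSet_Ioi fun r hr => ?_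
        have hr : 0 < r := hr
        rw [lintegral_Ici_rpow (by linarith) hr, hβ1, neg_div_neg_eq, div_eq_mul_inv,
          ENNReal.ofReal_mul (by positivity), ENNReal.mul_rpow_of_nonneg _ _ hp0.le,
          ENNReal.mul_rpow_of_nonneg _ _ hp0.le,
          ENNReal.ofReal_rpow_of_nonneg (by positivity) hp0.le,
          ENNReal.ofReal_rpow_of_nonneg (by positivity) hp0.le,
          show (r ^ (1 - μ)) ^ p = (r ^ a) ^ p * r ^ (-((μ + a - 1) * p)) by
            rw [← Real.rpow_mul hr.le, ← Real.rpow_mul hr.le, ← Real.rpow_add hr]; ring_nf,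
          ENNReal.ofReal_mul (by positivity)]
        ring
    _ = _ := by
        rw [lintegral_const_mul' _ _ ENNReal.ofReal_ne_top, ← mul_assoc,
          ← ENNReal.ofReal_mul hA0]
        rfl

end Hardy

/-! ### Weighted `L_p` norms and integrability near zero. -/

section Norms

variable {X : Type*} [NormedAddCommGroup X] [NormedSpace ℝ X] {p μ : ℝ} {f g : ℝ → X}

theorem wLpNorm_eq (hp : 0 < p) (f : ℝ → X) :
    wLpNorm p μ f =
      (∫⁻ t in Ioi (0 : ℝ), (ENNReal.ofReal (t ^ (1 - μ)) * ‖f t‖ₑ) ^ p) ^ (1 / p) := by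
  rw [wLpNorm, eLpNorm_eq_lintegral_rpow_enorm_toReal (by simpa using hp) ENNReal.ofReal_ne_top,
    ENNReal.toReal_ofReal hp.le]
  congr 1
  refine setLIntegral_congr_fun measurableSet_Ioi fun t ht => ?_
  simp only [enorm_smul, Real.enorm_of_nonneg (Real.rpow_nonneg (le_of_lt ht) _)]

theorem MemWLp.aestronglyMeasurable (h : MemWLp p μ f) :
    AEStronglyMeasurable f (volume.restrict (Ioi 0)) := by
  have h1 : AEStronglyMeasurable (fun t : ℝ => t ^ (μ - 1)) (volume.restrict (Ioi 0)) :=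
    (measurable_id.pow_const _).aestronglyMeasurable
  refine (h1.smul h.1).congr ?_
  filter_upwards [ae_restrict_mem measurableSet_Ioi] with t ht
  simp only [Pi.smul_apply', smul_smul]
  rw [← Real.rpow_add ht]
  simp

theorem memWLp_of_wLpNorm_lt_top (hf : AEStronglyMeasurable f (volume.restrict (Ioi 0)))
    (h : wLpNorm p μ f < ⊤) : MemWLp p μ f :=
  ⟨(measurable_id.pow_const _).aestronglyMeasurable.smul hf, h⟩

theorem MemWLp.wLpNorm_lt_top (h : MemWLp p μ f) : wLpNorm p μ f < ⊤ := h.2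

theorem wLpNorm_congr_ae (h : f =ᵐ[volume.restrict (Ioi 0)] g) :
    wLpNorm p μ f = wLpNorm p μ g := by
  refine eLpNorm_congr_ae ?_
  filter_upwards [h] with t ht
  rw [ht]

theorem wLpNorm_sub_le (hp : 1 < p) (hf : AEStronglyMeasurable f (volume.restrict (Ioi 0)))
    (hg : AEStronglyMeasurable g (volume.restrict (Ioi 0))) :
    wLpNorm p μ (fun t => f t - g t) ≤ wLpNorm p μ f + wLpNorm p μ g := by
  have hw : AEStronglyMeasurable (fun t : ℝ => t ^ (1 - μ)) (volume.restrict (Ioi 0)) :=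
    (measurable_id.pow_const _).aestronglyMeasurable
  have := eLpNorm_sub_le (hw.smul hf) (hw.smul hg)
    (p := ENNReal.ofReal p) (by simpa using hp.le)
  refine le_trans (le_of_eq ?_) this
  simp only [wLpNorm]
  congr 1
  ext t
  simp [smul_sub]

theorem wLpNorm_le_of_enorm_le (hp : 0 < p) {h : ℝ → ℝ≥0∞}
    (hfh : ∀ᵐ t ∂volume.restrict (Ioi 0), ‖f t‖ₑ ≤ h t) :
    wLpNorm p μ f ≤
      (∫⁻ t in Ioi (0 : ℝ), (ENNReal.ofReal (t ^ (1 - μ)) * h t) ^ p) ^ (1 / p) := by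
  rw [wLpNorm_eq hp]
  gcongr ?_ ^ _
  refine lintegral_mono_ae ?_
  filter_upwards [hfh] with t ht
  gcongr

theorem const_mul_Lp (hp : 0 < p) (c : ℝ≥0) (h : ℝ → ℝ≥0∞) (S : Set ℝ) :
    (∫⁻ t in S, (c * h t) ^ p) ^ (1 / p) = c * (∫⁻ t in S, h t ^ p) ^ (1 / p) := by
  simp_rw [ENNReal.mul_rpow_of_nonneg _ _ hp.le]
  rw [lintegral_const_mul' _ _ (ENNReal.rpow_ne_top_of_nonneg hp.le ENNReal.coe_ne_top),
    ENNReal.mul_rpow_of_nonneg _ _ (by positivity), ← ENNReal.rpow_mul,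
    mul_one_div_cancel hp.ne', ENNReal.rpow_one]

theorem exists_wLpNorm_primitive_const (hp : 1 < p) (hμ : 1 / p < μ) :
    ∃ C : ℝ≥0, ∀ w : ℝ → X, AEStronglyMeasurable w (volume.restrict (Ioi 0)) →
      (∫⁻ s in Ioi (0 : ℝ), (ENNReal.ofReal (s ^ (-μ)) * ∫⁻ r in Ioc 0 s, ‖w r‖ₑ) ^ p) ^ (1 / p) ≤
        C * wLpNorm p μ w := by
  have hp0 : 0 < p := by linarith
  obtain ⟨C, hC⟩ := exists_hardy_const hp hμ
  refine ⟨C ^ (1 / p), fun w hw => ?_⟩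
  rw [wLpNorm_eq hp0, ENNReal.coe_rpow_of_nonneg _ (by positivity),
    ← ENNReal.mul_rpow_of_nonneg _ _ (by positivity)]
  gcongr
  exact hC _ hw.enorm

/-- The condition `μ > 1/p` makes the weighted space embed into `L_1` near `0`, so primitives
starting at `0` make sense. Hardy's inequality already contains this: its left side is finite only
if `∫₀ˢ ‖f‖` is finite for almost every `s`. -/
theorem MemWLp.integrableOn_Ioc (hp : 1 < p) (hμ : 1 / p < μ) (h : MemWLp p μ f) (T : ℝ) :
    IntegrableOn f (Ioc 0 T) := by
  have hp0 : 0 < p := by linarith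
  refine ⟨h.aestronglyMeasurable.mono_measure
    (Measure.restrict_mono Ioc_subset_Ioi_self le_rfl), ?_⟩
  obtain ⟨C, hC⟩ := exists_wLpNorm_primitive_const (X := X) hp hμ
  have h1 := (hC f h.aestronglyMeasurable).trans_lt
    (ENNReal.mul_lt_top ENNReal.coe_lt_top h.wLpNorm_lt_top)
  rw [ENNReal.rpow_lt_top_iff_of_pos (by positivity)] at h1
  have hmeas : Measurable fun s : ℝ => ∫⁻ r in Ioc 0 s, ‖f r‖ₑ :=
    Monotone.measurable fun s t hst => lintegral_mono_set (Ioc_subset_Ioc_right hst)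
  have h2 := ae_lt_top' (by fun_prop) h1.ne
  rw [ae_restrict_iff' measurableSet_Ioi] at h2
  -- A null set cannot contain the half-line beyond `max T 0`, so some `s` there is good.
  have h3 : ∃ s, max T 0 < s ∧
      (ENNReal.ofReal (s ^ (-μ)) * ∫⁻ r in Ioc 0 s, ‖f r‖ₑ) ^ p < ⊤ := by
    by_contra! hcon
    have : volume (Ioi (max T 0)) = 0 := by
      refine measure_mono_null (fun s hs => ?_) h2
      simp only [mem_compl_iff, mem_ofPred_eq, Classical.not_imp, mem_Ioi, not_lt]
      exact ⟨(le_max_right T 0).trans_lt hs, hcon s hs⟩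
    simp at this
  obtain ⟨s, hs, hlt⟩ := h3
  have hs0 : 0 < s := (le_max_right T 0).trans_lt hs
  rw [ENNReal.rpow_lt_top_iff_of_pos hp0] at hlt
  have h4 : ∫⁻ r in Ioc 0 s, ‖f r‖ₑ < ⊤ := by
    refine ENNReal.lt_top_of_mul_ne_top_right hlt.ne ?_
    simpa using Real.rpow_pos_of_pos hs0 _
  exact (lintegral_mono_set (Ioc_subset_Ioc_right ((le_max_left T 0).trans hs.le))).trans_lt h4

end Norms

/-! ### The `K`-functional and the trace estimate. -/

section KFunctional

variable {X₀ X₁ : Type*} [NormedAddCommGroup X₀] [NormedSpace ℝ X₀]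
  [NormedAddCommGroup X₁] [NormedSpace ℝ X₁] {ι : X₁ →L[ℝ] X₀} {p μ : ℝ}

theorem kFunctional_le {x a : X₀} {b : X₁} (h : a + ι b = x) (t : ℝ) :
    kFunctional ι t x ≤ ‖a‖ₑ + ENNReal.ofReal t * ‖b‖ₑ :=
  iInf_le_of_le a (iInf_le_of_le b (iInf_le _ h))

theorem kFunctional_mono (x : X₀) : Monotone fun t => kFunctional ι t x := by
  intro s t hst
  simp only [kFunctional]
  gcongr

theorem kFunctional_le_enorm (t : ℝ) (x : X₀) : kFunctional ι t x ≤ ‖x‖ₑ := by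
  simpa using kFunctional_le (ι := ι) (a := x) (b := 0) (by simp) t

theorem kFunctional_two_mul_le (t : ℝ) (x : X₀) :
    kFunctional ι (2 * t) x ≤ 2 * kFunctional ι t x := by
  conv_rhs => rw [kFunctional]
  simp_rw [ENNReal.mul_iInf_of_ne two_ne_zero ENNReal.ofNat_ne_top]
  refine le_iInf fun a => le_iInf fun b => le_iInf fun h => (kFunctional_le h _).trans ?_
  rw [ENNReal.ofReal_mul zero_le_two, mul_add, ← mul_assoc, ENNReal.ofReal_ofNat]
  gcongr
  exact le_mul_of_one_le_left' one_le_two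

/-- Boundedness of `ι` gives `‖x‖ ≤ (1 + ‖ι‖/t) K(t,x)`. -/
theorem eq_zero_of_kFunctional_eq_zero {t : ℝ} (ht : 0 < t) {x : X₀}
    (h : kFunctional ι t x = 0) : x = 0 := by
  set c : ℝ≥0∞ := 1 + ‖ι‖ₑ * ENNReal.ofReal t⁻¹ with hc
  have hc_top : c ≠ ⊤ := by
    simp [hc, ENNReal.mul_eq_top]
  have hle : ‖x‖ₑ ≤ c * kFunctional ι t x := by
    rw [kFunctional]
    simp_rw [ENNReal.mul_iInf_of_ne (a := c) (by simp [hc]) hc_top]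
    refine le_iInf fun a => le_iInf fun b => le_iInf fun hx => ?_
    have hb : ‖b‖ₑ = ENNReal.ofReal t⁻¹ * (ENNReal.ofReal t * ‖b‖ₑ) := by
      rw [← mul_assoc, ← ENNReal.ofReal_mul (by positivity), inv_mul_cancel₀ ht.ne']
      simp
    calc ‖x‖ₑ ≤ ‖a‖ₑ + ‖ι b‖ₑ := hx ▸ enorm_add_le _ _
      _ ≤ ‖a‖ₑ + ‖ι‖ₑ * ‖b‖ₑ := by gcongr; exact ι.le_opENorm b
      _ = 1 * ‖a‖ₑ + (‖ι‖ₑ * ENNReal.ofReal t⁻¹) * (ENNReal.ofReal t * ‖b‖ₑ) := by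
          conv_lhs => rw [hb]
          ring
      _ ≤ c * ‖a‖ₑ + c * (ENNReal.ofReal t * ‖b‖ₑ) := by
          gcongr
          · exact le_self_add
          · exact le_add_self
      _ = _ := by ring
  rw [h, mul_zero] at hle
  simpa using hle

/-- Once `0 < K < ∞`, the factor `2` leaves strict room above the infimum; `K = 0` forces `x = 0`,
where `b = 0` works. -/
theorem exists_almost_minimizer {t : ℝ} (ht : 0 < t) (x : X₀) :
    ∃ b : X₁, ‖x - ι b‖ₑ + ENNReal.ofReal t * ‖b‖ₑ ≤ 2 * kFunctional ι t x := by
  by_cases hx : x = 0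
  · exact ⟨0, by simp [hx]⟩
  have hK : kFunctional ι t x ≠ 0 := fun h => hx (eq_zero_of_kFunctional_eq_zero ht h)
  have hK' : kFunctional ι t x ≠ ⊤ := ((kFunctional_le_enorm t x).trans_lt enorm_lt_top).ne
  have hlt : kFunctional ι t x < 2 * kFunctional ι t x := by
    rw [two_mul]; exact ENNReal.lt_add_right hK' hK
  conv_lhs at hlt => rw [kFunctional]
  simp only [iInf_lt_iff] at hlt
  obtain ⟨a, b, h, hab⟩ := hlt
  refine ⟨b, ?_⟩
  rw [← h, add_sub_cancel_right, h]
  exact hab.le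

/-- The choice `θ = μ - 1/p` absorbs the measure `dt/t`: `t^(-θp) dt/t = t^(-μp) dt`, which is the
weight in Hardy's inequality. -/
theorem interpNorm_eq (hp : 0 < p) (x : X₀) :
    interpNorm ι (μ - 1 / p) p x =
      (∫⁻ t in Ioi (0 : ℝ), (ENNReal.ofReal (t ^ (-μ)) * kFunctional ι t x) ^ p) ^ (1 / p) := by
  rw [interpNorm]
  congr 1
  refine setLIntegral_congr_fun measurableSet_Ioi fun t ht => ?_
  have ht : 0 < t := ht
  rw [ENNReal.mul_rpow_of_nonneg _ _ hp.le, ENNReal.mul_rpow_of_nonneg _ _ hp.le,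
    mul_right_comm, ENNReal.ofReal_rpow_of_nonneg (by positivity) hp.le,
    ENNReal.ofReal_rpow_of_nonneg (by positivity) hp.le, ← ENNReal.ofReal_mul (by positivity),
    ← Real.rpow_mul ht.le, ← Real.rpow_mul ht.le, ← Real.rpow_neg_one t, ← Real.rpow_add ht]
  congr 3
  field_simp
  ring

/-- The trace estimate: `x = u(s) - ∫₀ˢ w` for almost all `s` bounds the interpolation norm
of `x`. -/
theorem exists_interpNorm_le (ι : X₁ →L[ℝ] X₀) (hp : 1 < p) (hμ : 1 / p < μ) :
    ∃ C : ℝ≥0, ∀ (x : X₀) (u : ℝ → X₁) (w : ℝ → X₀),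
      AEStronglyMeasurable u (volume.restrict (Ioi 0)) →
      AEStronglyMeasurable w (volume.restrict (Ioi 0)) →
      (∀ᵐ s ∂volume.restrict (Ioi (0 : ℝ)), ι (u s) = x + ∫ r in (0 : ℝ)..s, w r) →
      interpNorm ι (μ - 1 / p) p x ≤ C * (wLpNorm p μ w + wLpNorm p μ u) := by
  have hp0 : 0 < p := by linarith
  obtain ⟨C, hC⟩ := exists_wLpNorm_primitive_const (X := X₀) hp hμ
  refine ⟨C + 1, fun x u w hu hw h => ?_⟩
  set F : ℝ → ℝ≥0∞ := fun s => ENNReal.ofReal (s ^ (-μ)) * ∫⁻ r in Ioc 0 s, ‖w r‖ₑ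
  set G : ℝ → ℝ≥0∞ := fun s => ENNReal.ofReal (s ^ (1 - μ)) * ‖u s‖ₑ with hG
  have hFm : Measurable F := by
    have hmeas : Measurable fun s : ℝ => ∫⁻ r in Ioc 0 s, ‖w r‖ₑ :=
      Monotone.measurable fun s t hst => lintegral_mono_set (Ioc_subset_Ioc_right hst)
    fun_prop
  have hGm : AEMeasurable G (volume.restrict (Ioi 0)) := by
    have := hu.enorm
    fun_prop
  have key : ∀ᵐ s ∂volume.restrict (Ioi (0 : ℝ)),
      ENNReal.ofReal (s ^ (-μ)) * kFunctional ι s x ≤ (F + G) s := by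
    filter_upwards [h, ae_restrict_mem measurableSet_Ioi] with s hs hs0
    have hs0 : 0 < s := hs0
    have h1 : kFunctional ι s x ≤ (∫⁻ r in Ioc 0 s, ‖w r‖ₑ) + ENNReal.ofReal s * ‖u s‖ₑ := by
      -- The splitting of `x` that carries the trace estimate.
      refine (kFunctional_le (a := -∫ r in (0 : ℝ)..s, w r) (b := u s) (by rw [hs]; abel) s).trans ?_
      gcongr
      rw [enorm_neg, intervalIntegral.integral_of_le hs0.le]
      exact enorm_integral_le_lintegral_enorm _
    calc _ ≤ ENNReal.ofReal (s ^ (-μ)) *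
          ((∫⁻ r in Ioc 0 s, ‖w r‖ₑ) + ENNReal.ofReal s * ‖u s‖ₑ) := by gcongr
      _ = _ := by
        simp only [Pi.add_apply, F, G]
        rw [mul_add, ← mul_assoc, ← ENNReal.ofReal_mul (by positivity), sub_eq_neg_add,
          Real.rpow_add hs0, Real.rpow_one]
  calc interpNorm ι (μ - 1 / p) p x
      ≤ (∫⁻ s in Ioi (0 : ℝ), ((F + G) s) ^ p) ^ (1 / p) := by
        rw [interpNorm_eq hp0]
        gcongr ?_ ^ _
        refine lintegral_mono_ae ?_
        filter_upwards [key] with s hs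
        gcongr
    _ ≤ (∫⁻ s in Ioi (0 : ℝ), F s ^ p) ^ (1 / p) + (∫⁻ s in Ioi (0 : ℝ), G s ^ p) ^ (1 / p) :=
        ENNReal.lintegral_Lp_add_le hFm.aemeasurable hGm hp.le
    _ ≤ C * wLpNorm p μ w + wLpNorm p μ u := by
        rw [wLpNorm_eq hp0 u]
        gcongr
        exact hC w hw
    _ ≤ _ := by
        rw [mul_add]
        push_cast
        gcongr
        · exact le_self_add
        · exact le_mul_of_one_le_left' le_add_self

end KFunctional

/-! ### Weak derivatives, primitives and the du Bois-Reymond lemma. -/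

section WeakDeriv

variable {X : Type*} [NormedAddCommGroup X] {u v w : ℝ → X}

theorem locallyIntegrableOn_congr_ae (h : u =ᵐ[volume.restrict (Ioi 0)] v)
    (hu : LocallyIntegrableOn u (Ioi 0) volume) : LocallyIntegrableOn v (Ioi 0) volume := by
  intro x hx
  obtain ⟨S, hS, hint⟩ := hu x hx
  refine ⟨S ∩ Ioi 0, Filter.inter_mem hS self_mem_nhdsWithin, ?_⟩
  exact (hint.mono_set inter_subset_left).congr_fun_ae
    (ae_restrict_of_ae_restrict_of_subset inter_subset_right h)

theorem locallyIntegrableOn_of_integrableOn_Ioc (hw : ∀ T : ℝ, IntegrableOn w (Ioc 0 T)) :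
    LocallyIntegrableOn w (Ioi 0) volume := by
  intro x hx
  have hx : 0 < x := hx
  exact ⟨Ioc 0 (x + 1), mem_nhdsWithin_of_mem_nhds (Ioc_mem_nhds hx (by linarith)), hw _⟩

/-- The point `0` is null, so two continuous representatives agree a.e. on `[0,∞)`, hence everywhere
there, including at `0`. -/
theorem IsTrace.eq {x : X} (h : IsTrace u x)
    (hv : v =ᵐ[volume.restrict (Ioi 0)] u) (hc : ContinuousOn v (Ici 0)) : v 0 = x := by
  obtain ⟨v', hv', hc', rfl⟩ := h
  have hae : v =ᵐ[volume.restrict (Ici 0)] v' := by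
    rw [← Measure.restrict_congr_set Ioi_ae_eq_Ici]
    exact hv.trans hv'.symm
  exact Measure.eqOn_of_ae_eq hae hc hc' (by simp) self_mem_Ici

variable [NormedSpace ℝ X]

theorem HasWeakDeriv.congr_ae (h : u =ᵐ[volume.restrict (Ioi 0)] v) (hu : HasWeakDeriv u w) :
    HasWeakDeriv v w where
  locallyIntegrable := locallyIntegrableOn_congr_ae h hu.locallyIntegrable
  locallyIntegrable_deriv := hu.locallyIntegrable_deriv
  integral_eq φ h1 h2 h3 := by
    rw [← hu.integral_eq φ h1 h2 h3]
    refine integral_congr_ae ?_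
    filter_upwards [h] with t ht
    rw [ht]

theorem integrable_smul_of_tsupport_subset {ψ : ℝ → ℝ} (hψ : Continuous ψ)
    (hc : HasCompactSupport ψ) (hs : tsupport ψ ⊆ Ioi 0)
    (hu : LocallyIntegrableOn u (Ioi 0) volume) :
    IntegrableOn (fun t => ψ t • u t) (Ioi 0) := by
  have h1 : IntegrableOn u (tsupport ψ) := hu.integrableOn_compact_subset hs hc
  have h2 : IntegrableOn (fun t => ψ t • u t) (tsupport ψ) :=
    h1.continuousOn_smul hψ.continuousOn hc
  refine Integrable.integrableOn ?_
  rw [← integrableOn_iff_integrable_of_support_subset (s := tsupport ψ)]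
  · exact h2
  · exact (Function.support_smul_subset_left _ _).trans (subset_tsupport ψ)

theorem continuousOn_primitive_Ici (x : X) (hw : ∀ T : ℝ, IntegrableOn w (Ioc 0 T)) :
    ContinuousOn (fun t => x + ∫ r in (0 : ℝ)..t, w r) (Ici 0) := by
  refine continuousOn_const.add ?_
  intro t ht
  have ht : 0 ≤ t := ht
  have h1 : ContinuousOn (fun t => ∫ r in (0 : ℝ)..t, w r) (uIcc 0 (t + 1)) := by
    refine intervalIntegral.continuousOn_primitive_interval ?_
    rw [uIcc_of_le (by linarith), integrableOn_Icc_iff_integrableOn_Ioc]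
    exact hw _
  rw [uIcc_of_le (by linarith)] at h1
  refine (h1 t ⟨ht, by linarith⟩).mono_of_mem_nhdsWithin ?_
  filter_upwards [self_mem_nhdsWithin, mem_nhdsWithin_of_mem_nhds (Iio_mem_nhds (lt_add_one t))]
    with s hs1 hs2
  exact ⟨hs1, le_of_lt hs2⟩

theorem setIntegral_Ioi_eq_integral_of_tsupport {ψ : ℝ → ℝ} (hs : tsupport ψ ⊆ Ioi 0) (f : ℝ → X) :
    ∫ t in Ioi (0 : ℝ), ψ t • f t = ∫ t, ψ t • f t := by
  refine setIntegral_eq_integral_of_forall_compl_eq_zero fun t ht => ?_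
  rw [image_eq_zero_of_notMem_tsupport fun h => ht (hs h), zero_smul]

theorem MemW1loc.hasWeakDeriv (h : MemW1loc u) : HasWeakDeriv u (weakDeriv u) := by
  have h' : ∃ v : ℝ → X, HasWeakDeriv u v := h
  rw [weakDeriv, dif_pos h']
  exact h'.choose_spec

variable [CompleteSpace X]

/-- Integration by parts through Fubini on the triangle `r ≤ t`, so `w` need only be integrable. The
inner integral of `deriv φ` over `[r,T]` is `-φ r`, as `φ` vanishes at `T`. -/
theorem setIntegral_deriv_smul_primitive {T : ℝ} {φ : ℝ → ℝ}
    (hw : IntegrableOn w (Ioc 0 T)) (hφ : ContDiff ℝ 1 φ) (hφT : φ T = 0) :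
    ∫ t in Ioc 0 T, deriv φ t • ∫ r in (0 : ℝ)..t, w r = -∫ r in Ioc 0 T, φ r • w r := by
  have hcont : Continuous (deriv φ) := hφ.continuous_deriv le_rfl
  set S : Set (ℝ × ℝ) := {z | z.2 ≤ z.1}
  have hS : MeasurableSet S := measurableSet_le measurable_snd measurable_fst
  have h1 : ∀ t ∈ Ioc 0 T, deriv φ t • ∫ r in (0 : ℝ)..t, w r =
      ∫ r in Ioc 0 T, S.indicator (fun z => deriv φ z.1 • w z.2) (t, r) := by
    intro t ht
    have : ∀ r, S.indicator (fun z => deriv φ z.1 • w z.2) (t, r) =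
        (Iic t).indicator (fun r => deriv φ t • w r) r := by
      intro r; simp [indicator, S]
    simp_rw [this]
    rw [integral_indicator measurableSet_Iic, Measure.restrict_restrict measurableSet_Iic,
      inter_comm, Ioc_inter_Iic, min_eq_right ht.2, integral_smul,
      intervalIntegral.integral_of_le ht.1.le]
  have h2 : ∀ r ∈ Ioc 0 T, -(φ r • w r) =
      ∫ t in Ioc 0 T, S.indicator (fun z => deriv φ z.1 • w z.2) (t, r) := by
    intro r hr
    have : ∀ t, S.indicator (fun z => deriv φ z.1 • w z.2) (t, r) =
        (Ici r).indicator (fun t => deriv φ t • w r) t := by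
      intro t; simp [indicator, S]
    simp_rw [this]
    have hset : Ici r ∩ Ioc 0 T = Icc r T := by
      ext t; simp only [mem_inter_iff, mem_Ici, mem_Ioc, mem_Icc]
      exact ⟨fun h => ⟨h.1, h.2.2⟩, fun h => ⟨h.1, hr.1.trans_le h.1, h.2⟩⟩
    rw [integral_indicator measurableSet_Ici, Measure.restrict_restrict measurableSet_Ici,
      hset, integral_Icc_eq_integral_Ioc, integral_smul_const,
      ← intervalIntegral.integral_of_le hr.2, intervalIntegral.integral_deriv_eq_sub
        (fun t _ => (hφ.differentiable one_ne_zero) t) (hcont.intervalIntegrable _ _), hφT, zero_sub,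
      neg_smul]
  rw [setIntegral_congr_fun measurableSet_Ioc h1, ← integral_neg,
    setIntegral_congr_fun measurableSet_Ioc h2, integral_integral_swap]
  refine Integrable.indicator ?_ hS
  exact Integrable.smul_prod (f := deriv φ) (g := w)
    (hcont.integrableOn_Icc.mono_set Ioc_subset_Icc_self) hw

theorem hasWeakDeriv_primitive (x : X) (hw : ∀ T : ℝ, IntegrableOn w (Ioc 0 T)) :
    HasWeakDeriv (fun t => x + ∫ r in (0 : ℝ)..t, w r) w where
  locallyIntegrable :=
    ((continuousOn_primitive_Ici x hw).mono Ioi_subset_Ici_self).locallyIntegrableOn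
      measurableSet_Ioi
  locallyIntegrable_deriv := locallyIntegrableOn_of_integrableOn_Ioc hw
  integral_eq φ h1 h2 h3 := by
    obtain ⟨b, hb⟩ := h2.isCompact.bddAbove
    -- The `+ 1` puts `T` strictly beyond the support, so `φ` and its derivative vanish from `T` on,
    -- and keeps `T` positive.
    set T := max b 0 + 1
    have hT : 0 < T := by positivity
    have hbT : ∀ t, T ≤ t → t ∉ tsupport φ := fun t ht hmem => by
      have := hb hmem
      have := le_max_left b 0
      simp only [T] at ht
      linarith
    have hφ0 : ∀ t, T ≤ t → φ t = 0 := fun t ht => image_eq_zero_of_notMem_tsupport (hbT t ht)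
    have hφ0' : ∀ t, T ≤ t → deriv φ t = 0 := fun t ht =>
      image_eq_zero_of_notMem_tsupport fun h => hbT t ht (tsupport_deriv_subset (𝕜 := ℝ) h)
    have hφ00 : φ 0 = 0 := image_eq_zero_of_notMem_tsupport fun h => lt_irrefl (0 : ℝ) (h3 h)
    have hφ1 : ContDiff ℝ 1 φ := h1.of_le (by simp)
    have hcont : Continuous (deriv φ) := hφ1.continuous_deriv le_rfl
    have hcut : ∀ (χ : ℝ → ℝ) (f : ℝ → X), (∀ t, T ≤ t → χ t = 0) →
        ∫ t in Ioi (0 : ℝ), χ t • f t = ∫ t in Ioc 0 T, χ t • f t := fun χ f hχ => by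
      refine setIntegral_eq_of_subset_of_forall_sdiff_eq_zero measurableSet_Ioi
        Ioc_subset_Ioi_self fun t ht => ?_
      rw [hχ t, zero_smul]
      by_contra! hlt
      exact ht.2 ⟨ht.1, hlt.le⟩
    rw [hcut _ _ hφ0', hcut _ _ hφ0]
    have hd : IntegrableOn (deriv φ) (Ioc 0 T) :=
      hcont.integrableOn_Icc.mono_set Ioc_subset_Icc_self
    have hprim : ContinuousOn (fun t => (0 : X) + ∫ r in (0 : ℝ)..t, w r) (Icc 0 T) :=
      (continuousOn_primitive_Ici 0 hw).mono Icc_subset_Ici_self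
    simp only [zero_add] at hprim
    simp only [smul_add]
    rw [integral_add (f := fun t => deriv φ t • x) (hd.smul_const x)
      (g := fun t => deriv φ t • ∫ r in (0 : ℝ)..t, w r) ((hcont.continuousOn.smul hprim).integrableOn_Icc.mono_set Ioc_subset_Icc_self),
      integral_smul_const, ← intervalIntegral.integral_of_le hT.le,
      intervalIntegral.integral_deriv_eq_sub
        (fun t _ => (hφ1.differentiable one_ne_zero) t) (hcont.intervalIntegrable _ _),
      hφ00, hφ0 T le_rfl, sub_zero, zero_smul, zero_add,
      setIntegral_deriv_smul_primitive (hw T) hφ1 (hφ0 T le_rfl)]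

/-- Zero mean makes the primitive from `0` vanish to the right of the support of `θ`; to the left it
vanishes because `θ` does. -/
theorem exists_primitive_testFunction {θ : ℝ → ℝ} (hθ : ContDiff ℝ ∞ θ)
    (hc : HasCompactSupport θ) (hs : tsupport θ ⊆ Ioi 0) (hint : ∫ t, θ t = 0) :
    ∃ φ : ℝ → ℝ, ContDiff ℝ ∞ φ ∧ HasCompactSupport φ ∧ tsupport φ ⊆ Ioi 0 ∧ deriv φ = θ := by
  have hcont := hθ.continuous
  have hderiv : ∀ t, HasDerivAt (fun t => ∫ r in (0 : ℝ)..t, θ r) (θ t) t := fun t =>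
    intervalIntegral.integral_hasDerivAt_right (hcont.intervalIntegrable _ _)
      (hcont.stronglyMeasurableAtFilter _ _) hcont.continuousAt
  have hderiv' : deriv (fun t => ∫ r in (0 : ℝ)..t, θ r) = θ := funext fun t => (hderiv t).deriv
  obtain ⟨a, b, ha, hab⟩ : ∃ a b : ℝ, 0 < a ∧ tsupport θ ⊆ Icc a b := by
    rcases (tsupport θ).eq_empty_or_nonempty with he | hne
    · exact ⟨1, 1, one_pos, by simp [he]⟩
    · obtain ⟨m, hm⟩ := hc.isCompact.exists_isLeast hne
      obtain ⟨M, hM⟩ := hc.isCompact.exists_isGreatest hne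
      exact ⟨m, M, hs hm.1, fun t ht => ⟨hm.2 ht, hM.2 ht⟩⟩
  have hzero : ∀ t, t ∉ Icc a b → θ t = 0 := fun t ht =>
    image_eq_zero_of_notMem_tsupport fun h => ht (hab h)
  have hsupp : ∀ t, t ∉ Icc a b → ∫ r in (0 : ℝ)..t, θ r = 0 := by
    intro t ht
    rcases lt_or_ge t a with h | h
    · refine intervalIntegral.integral_zero_ae (Filter.Eventually.of_forall fun r hr => hzero r ?_)
      intro hr'
      have := hr.2.trans_lt (max_lt ha h)
      exact absurd hr'.1 (not_le.2 this)
    · have hbt : b < t := by by_contra! hh; exact ht ⟨h, hh⟩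
      rw [intervalIntegral.integral_of_le (ha.le.trans h),
        setIntegral_eq_integral_of_forall_compl_eq_zero,
        hint]
      intro r hr
      refine hzero r fun hr' => hr ⟨ha.trans_le hr'.1, hr'.2.trans hbt.le⟩
  have hts : tsupport (fun t => ∫ r in (0 : ℝ)..t, θ r) ⊆ Icc a b :=
    closure_minimal (fun t ht => by by_contra h; exact ht (hsupp t h)) isClosed_Icc
  refine ⟨_, ?_, isCompact_Icc.of_isClosed_subset (isClosed_tsupport _) hts,
    hts.trans fun t ht => ha.trans_le ht.1, hderiv'⟩
  rw [contDiff_infty_iff_deriv, hderiv']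
  exact ⟨fun t => (hderiv t).differentiableAt, hθ⟩

/-- The du Bois-Reymond lemma. -/
theorem HasWeakDeriv.ae_eq_const (h : HasWeakDeriv u 0) :
    ∃ c : X, u =ᵐ[volume.restrict (Ioi 0)] fun _ => c := by
  let B : ContDiffBump (2 : ℝ) := ⟨1 / 2, 1, by norm_num, by norm_num⟩
  set χ : ℝ → ℝ := B.normed volume
  have hχ : ContDiff ℝ ∞ χ := B.contDiff_normed
  have hχc : HasCompactSupport χ := B.hasCompactSupport_normed
  have hχs : tsupport χ ⊆ Ioi 0 := by
    rw [B.tsupport_normed_eq, Real.closedBall_eq_Icc]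
    intro t ht
    have : (2 : ℝ) - 1 ≤ t := ht.1
    exact lt_of_lt_of_le (by norm_num) this
  have hχi : ∫ t, χ t = 1 := B.integral_normed
  -- For any test function `ψ`, `ψ - (∫ψ)χ` has mean zero, hence is the derivative of a test
  -- function and is annihilated by `u`. Thus `∫ψu = (∫ψ)c`.
  set c : X := ∫ t in Ioi (0 : ℝ), χ t • u t with hc
  refine ⟨c, ?_⟩
  have hloc : LocallyIntegrableOn (fun t => u t - c) (Ioi 0) volume :=
    h.locallyIntegrable.sub ((locallyIntegrable_const c).locallyIntegrableOn _)
  have key := isOpen_Ioi.ae_eq_zero_of_integral_contDiff_smul_eq_zero hloc fun ψ hψ hψc hψs => by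
    set m := ∫ t, ψ t with hm
    have hiψ : Integrable ψ := hψ.continuous.integrable_of_hasCompactSupport hψc
    have hiχ : Integrable χ := hχ.continuous.integrable_of_hasCompactSupport hχc
    have hsub : tsupport (fun t => ψ t - m * χ t) ⊆ tsupport ψ ∪ tsupport χ := by
      refine closure_minimal (fun t ht => ?_) ((isClosed_tsupport _).union (isClosed_tsupport _))
      by_contra hcon
      rw [mem_union, not_or] at hcon
      refine ht ?_
      simp [image_eq_zero_of_notMem_tsupport hcon.1, image_eq_zero_of_notMem_tsupport hcon.2]
    obtain ⟨φ, h1, h2, h3, h4⟩ := exists_primitive_testFunction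
      (θ := fun t => ψ t - m * χ t) (hψ.sub (contDiff_const.mul hχ))
      ((hψc.isCompact.union hχc.isCompact).of_isClosed_subset (isClosed_tsupport _) hsub)
      (hsub.trans (union_subset hψs hχs))
      (by rw [integral_sub hiψ (hiχ.const_mul m), integral_const_mul, hχi, mul_one, sub_self])
    have h5 := h.integral_eq φ h1 h2 h3
    simp only [h4, Pi.zero_apply, smul_zero, integral_zero, neg_zero, sub_smul, mul_smul] at h5
    have hi1 := integrable_smul_of_tsupport_subset hψ.continuous hψc hψs h.locallyIntegrable
    have hi2 := integrable_smul_of_tsupport_subset hχ.continuous hχc hχs h.locallyIntegrable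
    rw [integral_sub hi1 (g := fun t => m • χ t • u t) (hi2.smul m), integral_smul, ← hc] at h5
    rw [← setIntegral_Ioi_eq_integral_of_tsupport hψs]
    simp only [smul_sub]
    rw [integral_sub hi1 (hiψ.integrableOn.smul_const c),
      setIntegral_Ioi_eq_integral_of_tsupport hψs (fun _ => c), integral_smul_const, ← hm]
    exact h5
  rw [Filter.EventuallyEq, ae_restrict_iff' measurableSet_Ioi]
  filter_upwards [key] with t ht ht0
  exact sub_eq_zero.1 (ht ht0)

theorem HasWeakDeriv.exists_ae_eq_primitive (h : HasWeakDeriv u w)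
    (hw : ∀ T : ℝ, IntegrableOn w (Ioc 0 T)) :
    ∃ x : X, u =ᵐ[volume.restrict (Ioi 0)] fun t => x + ∫ r in (0 : ℝ)..t, w r := by
  have h0 := hasWeakDeriv_primitive 0 hw
  have hd : HasWeakDeriv (fun t => u t - (0 + ∫ r in (0 : ℝ)..t, w r)) 0 := by
    refine ⟨h.locallyIntegrable.sub h0.locallyIntegrable,
      (locallyIntegrable_zero).locallyIntegrableOn _, fun φ h1 h2 h3 => ?_⟩
    have hφc : Continuous (deriv φ) := h1.continuous_deriv (by simp)
    have hφs : tsupport (deriv φ) ⊆ Ioi 0 := (tsupport_deriv_subset (𝕜 := ℝ)).trans h3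
    simp only [smul_sub]
    rw [integral_sub
      (integrable_smul_of_tsupport_subset hφc h2.deriv hφs h.locallyIntegrable)
      (integrable_smul_of_tsupport_subset hφc h2.deriv hφs h0.locallyIntegrable),
      h.integral_eq φ h1 h2 h3, h0.integral_eq φ h1 h2 h3]
    simp
  obtain ⟨c, hc⟩ := hd.ae_eq_const
  refine ⟨c, ?_⟩
  filter_upwards [hc] with t ht
  rw [← ht]
  simp

/-- Needed because `weakDeriv` is an arbitrary choice: it transfers norms computed from an explicit
derivative. -/
theorem HasWeakDeriv.ae_unique (h : HasWeakDeriv u v) (h' : HasWeakDeriv u w) :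
    v =ᵐ[volume.restrict (Ioi 0)] w := by
  have key := isOpen_Ioi.ae_eq_zero_of_integral_contDiff_smul_eq_zero
    (h.locallyIntegrable_deriv.sub h'.locallyIntegrable_deriv) fun ψ hψ hψc hψs => by
    rw [← setIntegral_Ioi_eq_integral_of_tsupport hψs]
    simp only [Pi.sub_apply, smul_sub]
    rw [integral_sub
      (integrable_smul_of_tsupport_subset hψ.continuous hψc hψs h.locallyIntegrable_deriv)
      (integrable_smul_of_tsupport_subset hψ.continuous hψc hψs h'.locallyIntegrable_deriv),
      sub_eq_zero, ← neg_inj, ← h.integral_eq ψ hψ hψc hψs, ← h'.integral_eq ψ hψ hψc hψs]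
  rw [Filter.EventuallyEq, ae_restrict_iff' measurableSet_Ioi]
  filter_upwards [key] with t ht ht0
  exact sub_eq_zero.1 (ht ht0)

end WeakDeriv

/-! ### Translations in the weighted spaces. -/

section Translation

variable {X : Type*} [NormedAddCommGroup X] [NormedSpace ℝ X] {p μ : ℝ} {f g : ℝ → X}

theorem measurePreserving_add_right_Ioi (h : ℝ) :
    MeasurePreserving (· + h) (volume.restrict (Ioi 0)) (volume.restrict (Ioi h)) := by
  have := (measurePreserving_add_right (volume : Measure ℝ) h).restrict_preimage
    (measurableSet_Ioi (a := h))
  simpa using this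

theorem quasiMeasurePreserving_add_right_Ioi {h : ℝ} (hh : 0 ≤ h) :
    Measure.QuasiMeasurePreserving (· + h) (volume.restrict (Ioi 0)) (volume.restrict (Ioi 0)) :=
  (measurePreserving_add_right_Ioi h).quasiMeasurePreserving.mono_right
    (Measure.restrict_mono (Ioi_subset_Ioi hh) le_rfl).absolutelyContinuous

/-- For `μ ≤ 1` the weight is nondecreasing, so `t^(1-μ) ≤ (t+h)^(1-μ)`; then change variables and
enlarge the domain. -/
theorem wLpNorm_comp_add_right_le (hp : 0 < p) (hμ : μ ≤ 1) {h : ℝ} (hh : 0 ≤ h) (f : ℝ → X) :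
    wLpNorm p μ (fun t => f (t + h)) ≤ wLpNorm p μ f := by
  rw [wLpNorm_eq hp, wLpNorm_eq hp]
  gcongr ?_ ^ _
  calc ∫⁻ t in Ioi (0 : ℝ), (ENNReal.ofReal (t ^ (1 - μ)) * ‖f (t + h)‖ₑ) ^ p
      ≤ ∫⁻ t in Ioi (0 : ℝ), (ENNReal.ofReal ((t + h) ^ (1 - μ)) * ‖f (t + h)‖ₑ) ^ p := by
        refine setLIntegral_mono' measurableSet_Ioi fun t ht => ?_
        have ht : 0 < t := ht
        gcongr
        linarith
    _ = ∫⁻ t in Ioi h, (ENNReal.ofReal (t ^ (1 - μ)) * ‖f t‖ₑ) ^ p :=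
        (measurePreserving_add_right_Ioi h).lintegral_comp_emb
          (MeasurableEquiv.addRight h).measurableEmbedding
          (fun t => (ENNReal.ofReal (t ^ (1 - μ)) * ‖f t‖ₑ) ^ p)
    _ ≤ _ := lintegral_mono_set (Ioi_subset_Ioi hh)

theorem wLpNorm_comp_add_right_sub_le (hp : 0 < p) (hμ : μ ≤ 1) {s : ℝ} (hs : 0 ≤ s) (h : ℝ)
    (f : ℝ → X) : wLpNorm p μ (fun t => f (t + (s + h)) - f (t + s)) ≤
      wLpNorm p μ (fun t => f (t + h) - f t) := by
  refine le_trans (le_of_eq ?_) (wLpNorm_comp_add_right_le hp hμ hs (fun t => f (t + h) - f t))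
  simp only [add_assoc]

/-- The measure `t^((1-μ)p) dt` on `(0,∞)`. -/
def weightMeasure (p μ : ℝ) : Measure ℝ :=
  (volume.restrict (Ioi 0)).withDensity fun t => ENNReal.ofReal (t ^ ((1 - μ) * p))

theorem wLpNorm_eq_eLpNorm_weightMeasure (hp : 0 < p) (f : ℝ → X) :
    wLpNorm p μ f = eLpNorm f (ENNReal.ofReal p) (weightMeasure p μ) := by
  rw [wLpNorm_eq hp, eLpNorm_eq_lintegral_rpow_enorm_toReal (by simpa using hp)
    ENNReal.ofReal_ne_top, ENNReal.toReal_ofReal hp.le, weightMeasure,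
    lintegral_withDensity_eq_lintegral_mul_non_measurable _
      (by fun_prop)
      (Filter.Eventually.of_forall fun _ => ENNReal.ofReal_lt_top)]
  congr 1
  refine setLIntegral_congr_fun measurableSet_Ioi fun t ht => ?_
  have ht : 0 < t := ht
  simp only [Pi.mul_apply]
  rw [ENNReal.mul_rpow_of_nonneg _ _ hp.le, ENNReal.ofReal_rpow_of_nonneg (by positivity) hp.le,
    ← Real.rpow_mul ht.le]

/-- For `μ ≤ 1` the density is continuous up to `0`. Local finiteness is used for the density of
compactly supported continuous functions. -/
theorem isLocallyFiniteMeasure_weightMeasure (hp : 0 < p) (hμ : μ ≤ 1) :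
    IsLocallyFiniteMeasure (weightMeasure p μ) := by
  exact .withDensity_ofReal
    (Real.continuous_rpow_const (mul_nonneg (sub_nonneg.2 hμ) hp.le))

theorem exists_wLpNorm_comp_add_right_sub_le_of_continuous (hp : 0 < p) (hμ : μ ≤ 1)
    (hg : Continuous g) (hc : HasCompactSupport g) {ε : ℝ≥0∞} (hε : ε ≠ 0) :
    ∃ δ : ℝ, 0 < δ ∧ ∀ h, 0 ≤ h → h < δ → wLpNorm p μ (fun t => g (t + h) - g t) ≤ ε := by
  obtain ⟨R, hR⟩ := hc.isCompact.bddAbove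
  have hsupp : ∀ t, R < t → g t = 0 := fun t ht =>
    image_eq_zero_of_notMem_tsupport fun hmem => absurd (hR hmem) (not_le.2 ht)
  set M : ℝ≥0∞ := (∫⁻ t in Ioi (0 : ℝ),
    (ENNReal.ofReal (t ^ (1 - μ)) * (Iic R).indicator 1 t) ^ p) ^ (1 / p) with hM
  have hM_top : M ≠ ⊤ := by
    refine ENNReal.rpow_ne_top_of_nonneg (by positivity) (ne_of_lt ?_)
    calc ∫⁻ t in Ioi (0 : ℝ), (ENNReal.ofReal (t ^ (1 - μ)) * (Iic R).indicator 1 t) ^ p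
        ≤ ∫⁻ t in Ioi (0 : ℝ), (Iic R).indicator
            (fun _ => ENNReal.ofReal (R ^ (1 - μ)) ^ p) t := by
          refine setLIntegral_mono' measurableSet_Ioi fun t ht => ?_
          have ht : 0 < t := ht
          by_cases h : t ∈ Iic R
          · have h' : t ≤ R := h
            simp only [indicator_of_mem h, Pi.one_apply, mul_one]
            gcongr
          · simp [indicator_of_notMem h, hp]
      _ = ENNReal.ofReal (R ^ (1 - μ)) ^ p * volume (Iic R ∩ Ioi 0) := by
          rw [lintegral_indicator measurableSet_Iic, setLIntegral_const,
            Measure.restrict_apply measurableSet_Iic]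
      _ < ⊤ := by
          refine ENNReal.mul_lt_top (ENNReal.rpow_lt_top_of_nonneg hp.le ENNReal.ofReal_ne_top) ?_
          rw [inter_comm, Ioi_inter_Iic]
          exact measure_Ioc_lt_top
  obtain ⟨η, hη, hηM⟩ := ENNReal.exists_nnreal_pos_mul_lt hM_top hε
  obtain ⟨δ, hδ, hδg⟩ := Metric.uniformContinuous_iff.1
    (hc.uniformContinuous_of_continuous hg) η hη
  refine ⟨δ, hδ, fun h hh hhδ => le_trans ?_ hηM.le⟩
  refine (wLpNorm_le_of_enorm_le hp (h := fun t => η * (Iic R).indicator 1 t) ?_).trans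
    (le_of_eq ?_)
  · refine Filter.Eventually.of_forall fun t => ?_
    -- Since `h ≥ 0`, both `g t` and `g (t + h)` vanish beyond `R`, so the same cutoff serves for
    -- all `h`.
    by_cases ht : t ∈ Iic R
    · have : dist (g (t + h)) (g t) < η := hδg (by simpa [abs_of_nonneg hh] using hhδ)
      rw [dist_eq_norm] at this
      simp only [indicator_of_mem ht, Pi.one_apply, mul_one]
      rw [← ofReal_norm, ENNReal.ofReal_le_iff_le_toReal ENNReal.coe_ne_top]
      exact this.le
    · have ht' : R < t := not_le.1 ht
      simp [hsupp t ht', hsupp (t + h) (by linarith)]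
  · rw [hM, ← const_mul_Lp hp]
    simp_rw [mul_left_comm]

/-- Strong continuity of translations in `L_{p,μ}(ℝ₊; X)`. -/
theorem MemWLp.exists_wLpNorm_comp_add_right_sub_le (hp : 1 < p) (hμ : μ ≤ 1)
    (hf : MemWLp p μ f) {ε : ℝ≥0∞} (hε : ε ≠ 0) :
    ∃ δ : ℝ, 0 < δ ∧ ∀ h, 0 ≤ h → h < δ → wLpNorm p μ (fun t => f (t + h) - f t) ≤ ε := by
  have hp0 : 0 < p := by linarith
  have := isLocallyFiniteMeasure_weightMeasure hp0 hμ
  have hfν : MemLp f (ENNReal.ofReal p) (weightMeasure p μ) :=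
    ⟨hf.aestronglyMeasurable.mono_ac (withDensity_absolutelyContinuous _ _), by
      rw [← wLpNorm_eq_eLpNorm_weightMeasure hp0]; exact hf.wLpNorm_lt_top⟩
  have hε3 : ε / 3 ≠ 0 := by simp [hε]
  obtain ⟨g, hgc, hfg, hg, -⟩ :=
    hfν.exists_hasCompactSupport_eLpNorm_sub_le ENNReal.ofReal_ne_top hε3
  have hfg' : wLpNorm p μ (fun t => f t - g t) ≤ ε / 3 := by
    rw [wLpNorm_eq_eLpNorm_weightMeasure hp0]; exact hfg
  obtain ⟨δ, hδ, hδg⟩ := exists_wLpNorm_comp_add_right_sub_le_of_continuous hp0 hμ hg hgc hε3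
  refine ⟨δ, hδ, fun h hh hhδ => ?_⟩
  have hfm := hf.aestronglyMeasurable
  have hgm : AEStronglyMeasurable g (volume.restrict (Ioi 0)) := hg.aestronglyMeasurable
  have hfgm : AEStronglyMeasurable (fun t => f t - g t) (volume.restrict (Ioi 0)) := hfm.sub hgm
  have hgm' : AEStronglyMeasurable (fun t => g (t + h)) (volume.restrict (Ioi 0)) :=
    (hg.comp (continuous_add_const h)).aestronglyMeasurable
  have hfgm' : AEStronglyMeasurable (fun t => f (t + h) - g (t + h)) (volume.restrict (Ioi 0)) :=
    hfgm.comp_quasiMeasurePreserving (quasiMeasurePreserving_add_right_Ioi hh)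
  calc wLpNorm p μ (fun t => f (t + h) - f t)
      = wLpNorm p μ (fun t => (f (t + h) - g (t + h)) - ((f t - g t) - (g (t + h) - g t))) := by
        congr 1; ext t; abel
    _ ≤ wLpNorm p μ (fun t => f (t + h) - g (t + h)) +
          wLpNorm p μ (fun t => (f t - g t) - (g (t + h) - g t)) :=
        wLpNorm_sub_le hp hfgm' (hfgm.sub (hgm'.sub hgm))
    _ ≤ ε / 3 + (ε / 3 + ε / 3) := by
        gcongr
        · exact (wLpNorm_comp_add_right_le hp0 hμ hh (fun t => f t - g t)).trans hfg'
        · refine (wLpNorm_sub_le hp hfgm (hgm'.sub hgm)).trans ?_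
          gcongr
          exact hδg h hh hhδ
    _ = ε := by rw [← add_assoc, ENNReal.add_thirds]

end Translation

/-! ### Bounds on the trace and the BUC embedding. -/

section Trace

variable {X₀ X₁ : Type*} [NormedAddCommGroup X₀] [NormedSpace ℝ X₀]
  [NormedAddCommGroup X₁] [NormedSpace ℝ X₁] {ι : X₁ →L[ℝ] X₀} {p μ : ℝ}

theorem kFunctional_neg (t : ℝ) (x : X₀) : kFunctional ι t (-x) = kFunctional ι t x := by
  have key : ∀ y : X₀, kFunctional ι t (-y) ≤ kFunctional ι t y := fun y =>
    le_iInf fun a => le_iInf fun b => le_iInf fun h => by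
      have := kFunctional_le (ι := ι) (x := -y) (a := -a) (b := -b) (by rw [← h]; simp; abel) t
      simpa using this
  exact le_antisymm (key x) (by simpa using key (-x))

theorem interpNorm_neg (θ : ℝ) (x : X₀) : interpNorm ι θ p (-x) = interpNorm ι θ p x := by
  simp only [interpNorm, kFunctional_neg]

/-- A translate is again a primitive, now with initial value the continuous representative at `s`;
the trace estimate thus applies at every time. -/
theorem ae_eq_primitive_comp_add_right {u : ℝ → X₁} {w : ℝ → X₀} {x : X₀}
    (hw : ∀ T : ℝ, IntegrableOn w (Ioc 0 T))
    (h : (fun t => ι (u t)) =ᵐ[volume.restrict (Ioi 0)] fun t => x + ∫ r in (0 : ℝ)..t, w r)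
    {s : ℝ} (hs : 0 ≤ s) :
    ∀ᵐ t ∂volume.restrict (Ioi (0 : ℝ)),
      ι (u (t + s)) = (x + ∫ r in (0 : ℝ)..s, w r) + ∫ r in (0 : ℝ)..t, w (r + s) := by
  filter_upwards [(quasiMeasurePreserving_add_right_Ioi hs).ae h,
    ae_restrict_mem measurableSet_Ioi] with t ht ht0
  have ht0 : 0 < t := ht0
  have hi : ∀ a b : ℝ, 0 ≤ a → a ≤ b → IntervalIntegrable w volume a b := fun a b ha hab => by
    rw [intervalIntegrable_iff_integrableOn_Ioc_of_le hab]
    exact (hw b).mono_set (Ioc_subset_Ioc_left ha)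
  rw [ht, intervalIntegral.integral_comp_add_right (fun r => w r), zero_add, add_assoc,
    intervalIntegral.integral_add_adjacent_intervals (hi 0 s le_rfl hs)
      (hi s (t + s) hs (by linarith))]

/-- Bounds in the interpolation norm for the continuous representative of an element of
`𝔼_{1,μ}` and for its increments. -/
theorem exists_interpNorm_primitive_le (ι : X₁ →L[ℝ] X₀) (hp : 1 < p) (hμ : 1 / p < μ)
    (hμ1 : μ ≤ 1) :
    ∃ C : ℝ≥0, ∀ (x : X₀) (u : ℝ → X₁) (w : ℝ → X₀), MemWLp p μ u → MemWLp p μ w →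
      (fun t => ι (u t)) =ᵐ[volume.restrict (Ioi 0)] (fun t => x + ∫ r in (0 : ℝ)..t, w r) →
      (∀ s, 0 ≤ s → interpNorm ι (μ - 1 / p) p (x + ∫ r in (0 : ℝ)..s, w r) ≤
        C * (wLpNorm p μ w + wLpNorm p μ u)) ∧
      ∀ s h, 0 ≤ s → 0 ≤ h → interpNorm ι (μ - 1 / p) p
          ((x + ∫ r in (0 : ℝ)..(s + h), w r) - (x + ∫ r in (0 : ℝ)..s, w r)) ≤
        C * (wLpNorm p μ (fun t => w (t + h) - w t) + wLpNorm p μ (fun t => u (t + h) - u t)) := by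
  have hp0 : 0 < p := by linarith
  obtain ⟨C, hC⟩ := exists_interpNorm_le ι hp hμ
  refine ⟨C, fun x u w hu hw h => ?_⟩
  have hwi : ∀ T : ℝ, IntegrableOn w (Ioc 0 T) := fun T => hw.integrableOn_Ioc hp hμ T
  have hum : ∀ s, 0 ≤ s → AEStronglyMeasurable (fun t => u (t + s)) (volume.restrict (Ioi 0)) :=
    fun s hs => hu.aestronglyMeasurable.comp_quasiMeasurePreserving
      (quasiMeasurePreserving_add_right_Ioi hs)
  have hwm : ∀ s, 0 ≤ s → AEStronglyMeasurable (fun t => w (t + s)) (volume.restrict (Ioi 0)) :=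
    fun s hs => hw.aestronglyMeasurable.comp_quasiMeasurePreserving
      (quasiMeasurePreserving_add_right_Ioi hs)
  refine ⟨fun s hs => ?_, fun s h' hs hh => ?_⟩
  · refine (hC _ _ _ (hum s hs) (hwm s hs) (ae_eq_primitive_comp_add_right hwi h hs)).trans ?_
    gcongr
    · exact wLpNorm_comp_add_right_le hp0 hμ1 hs w
    · exact wLpNorm_comp_add_right_le hp0 hμ1 hs u
  · have hsh : 0 ≤ s + h' := add_nonneg hs hh
    -- The increment is itself the initial value of the difference of two translates.
    refine (hC _ (fun t => u (t + (s + h')) - u (t + s)) (fun t => w (t + (s + h')) - w (t + s))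
      ((hum _ hsh).sub (hum s hs)) ((hwm _ hsh).sub (hwm s hs)) ?_).trans ?_
    · filter_upwards [ae_eq_primitive_comp_add_right hwi h hsh,
        ae_eq_primitive_comp_add_right hwi h hs, ae_restrict_mem measurableSet_Ioi] with t h1 h2 ht
      have ht : 0 < t := ht
      have hi : ∀ s, 0 ≤ s → IntervalIntegrable (fun r => w (r + s)) volume 0 t := fun s hs => by
        have : IntervalIntegrable w volume (0 + s) (t + s) := by
          rw [intervalIntegrable_iff_integrableOn_Ioc_of_le (by linarith)]
          exact (hwi _).mono_set (Ioc_subset_Ioc_left (by linarith))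
        simpa using this.comp_add_right s
      rw [map_sub, h1, h2, intervalIntegral.integral_sub (hi _ hsh) (hi _ hs)]
      abel
    · gcongr
      · exact wLpNorm_comp_add_right_sub_le hp0 hμ1 hs h' w
      · exact wLpNorm_comp_add_right_sub_le hp0 hμ1 hs h' u

theorem wLpNorm_weakDeriv_add_le_eNorm (hp : 0 < p) (u : ℝ → X₁) :
    wLpNorm p μ (weakDeriv fun t => ι (u t)) + wLpNorm p μ u ≤ eNorm ι p μ u := by
  rw [eNorm, wNorm]
  gcongr
  rw [one_div, ENNReal.le_rpow_inv_iff hp]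
  exact le_add_self

theorem MemE.eNorm_lt_top {u : ℝ → X₁} (hp : 0 < p) (hu : MemE ι p μ u) :
    eNorm ι p μ u < ⊤ := by
  refine ENNReal.add_lt_top.2 ⟨ENNReal.rpow_lt_top_of_nonneg (by positivity) (ne_of_lt ?_),
    hu.memWLp.wLpNorm_lt_top⟩
  exact ENNReal.add_lt_top.2
    ⟨ENNReal.rpow_lt_top_of_nonneg hp.le hu.memW.memWLp.wLpNorm_lt_top.ne,
      ENNReal.rpow_lt_top_of_nonneg hp.le hu.memW.memWLp_deriv.wLpNorm_lt_top.ne⟩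

variable [CompleteSpace X₀]

theorem MemE.exists_ae_eq_primitive {u : ℝ → X₁} (hp : 1 < p) (hμ : 1 / p < μ)
    (hu : MemE ι p μ u) : ∃ x : X₀, (fun t => ι (u t)) =ᵐ[volume.restrict (Ioi 0)]
      fun t => x + ∫ r in (0 : ℝ)..t, weakDeriv (fun t => ι (u t)) r :=
  hu.memW.memW1loc.hasWeakDeriv.exists_ae_eq_primitive
    fun T => hu.memW.memWLp_deriv.integrableOn_Ioc hp hμ T

theorem exists_interpNorm_le_traceNorm (ι : X₁ →L[ℝ] X₀) (hp : 1 < p) (hμ : 1 / p < μ)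
    (hμ1 : μ ≤ 1) :
    ∃ C : ℝ≥0, ∀ (u : ℝ → X₁) (x : X₀), MemE ι p μ u → IsTrace (fun t => ι (u t)) x →
      interpNorm ι (μ - 1 / p) p x ≤ C * eNorm ι p μ u := by
  have hp0 : 0 < p := by linarith
  obtain ⟨C, hC⟩ := exists_interpNorm_primitive_le ι hp hμ hμ1
  refine ⟨C, fun u x hu hx => ?_⟩
  obtain ⟨y, hy⟩ := hu.exists_ae_eq_primitive hp hμ
  have hw := hu.memW.memWLp_deriv
  have hyx := hx.eq hy.symm (continuousOn_primitive_Ici y fun T => hw.integrableOn_Ioc hp hμ T)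
  rw [← hyx]
  refine ((hC y u _ hu.memWLp hw hy).1 0 le_rfl).trans ?_
  gcongr
  exact wLpNorm_weakDeriv_add_le_eNorm hp0 u

/-- The embedding of `𝔼_{1,μ}` into the bounded uniformly continuous functions with values in the
interpolation space. -/
theorem exists_isBUC_bucNorm_le (ι : X₁ →L[ℝ] X₀) (hp : 1 < p) (hμ : 1 / p < μ) (hμ1 : μ ≤ 1) :
    ∃ C : ℝ≥0, ∀ u : ℝ → X₁, MemE ι p μ u →
      ∃ v : ℝ → X₀, v =ᵐ[volume.restrict (Ioi 0)] (fun t => ι (u t)) ∧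
        IsBUC ι (μ - 1 / p) p v ∧ bucNorm ι (μ - 1 / p) p v ≤ C * eNorm ι p μ u := by
  have hp0 : 0 < p := by linarith
  obtain ⟨C, hC⟩ := exists_interpNorm_primitive_le ι hp hμ hμ1
  refine ⟨C, fun u hu => ?_⟩
  obtain ⟨x, hx⟩ := hu.exists_ae_eq_primitive hp hμ
  have hw := hu.memW.memWLp_deriv
  set w := weakDeriv fun t => ι (u t)
  obtain ⟨hbd, hinc⟩ := hC x u w hu.memWLp hw hx
  have hbd' : ∀ s, 0 ≤ s → interpNorm ι (μ - 1 / p) p (x + ∫ r in (0 : ℝ)..s, w r) ≤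
      C * eNorm ι p μ u := fun s hs => (hbd s hs).trans (by
    gcongr
    exact wLpNorm_weakDeriv_add_le_eNorm hp0 u)
  have hfin : C * eNorm ι p μ u < ⊤ := ENNReal.mul_lt_top ENNReal.coe_lt_top (hu.eNorm_lt_top hp0)
  refine ⟨_, hx.symm, ⟨fun t ht => (hbd' t ht).trans_lt hfin,
    ⟨(C * eNorm ι p μ u).toNNReal, fun t ht => ?_⟩, fun ε hε => ?_⟩,
    iSup_le fun t => iSup_le fun ht => hbd' t ht⟩
  · rw [ENNReal.coe_toNNReal hfin.ne]
    exact hbd' t ht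
  · obtain ⟨η, hη, hηC⟩ := ENNReal.exists_nnreal_pos_mul_lt (a := 2 * C) (b := ε)
      (ENNReal.mul_ne_top ENNReal.ofNat_ne_top ENNReal.coe_ne_top) (by simpa using hε.ne')
    have hη' : (η : ℝ≥0∞) ≠ 0 := by simpa using hη.ne'
    obtain ⟨δ₁, hδ₁, h1⟩ := hw.exists_wLpNorm_comp_add_right_sub_le hp hμ1 hη'
    obtain ⟨δ₂, hδ₂, h2⟩ := hu.memWLp.exists_wLpNorm_comp_add_right_sub_le hp hμ1 hη'
    have key : ∀ s h, 0 ≤ s → 0 ≤ h → h < min δ₁ δ₂ → interpNorm ι (μ - 1 / p) p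
        ((x + ∫ r in (0 : ℝ)..(s + h), w r) - (x + ∫ r in (0 : ℝ)..s, w r)) < ε := by
      intro s h hs hh hlt
      refine (hinc s h hs hh).trans_lt (lt_of_le_of_lt ?_ hηC)
      calc _ ≤ C * ((η : ℝ≥0∞) + η) := by
            gcongr
            · exact h1 h hh (hlt.trans_le (min_le_left _ _))
            · exact h2 h hh (hlt.trans_le (min_le_right _ _))
        _ = _ := by ring
    refine ⟨min δ₁ δ₂, lt_min hδ₁ hδ₂, fun s t hs ht hst => ?_⟩
    rcases le_total t s with hts | hts
    · have := key t (s - t) ht (by linarith) (by rwa [abs_of_nonneg (by linarith)] at hst)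
      rwa [add_sub_cancel] at this
    -- Only forward shifts are controlled, so this order of `s` and `t` goes through the symmetry of
    -- the norm under negation.
    · have := key s (t - s) hs (by linarith)
        (by rwa [abs_sub_comm, abs_of_nonneg (by linarith)] at hst)
      rwa [add_sub_cancel, ← interpNorm_neg, neg_sub] at this

end Trace

/-! ### Interpolation of a sequence, affine in `log t`. -/

section LinInterp

variable {X : Type*} [NormedAddCommGroup X] [NormedSpace ℝ X] {b : ℤ → X}

/-- The continuous function on `ℝ` that is affine between consecutive integers and takes the value
`b n` at `n`. -/
def linInterp (b : ℤ → X) (s : ℝ) : X := b ⌊s⌋ + Int.fract s • (b (⌊s⌋ + 1) - b ⌊s⌋)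

theorem continuous_linInterp (b : ℤ → X) : Continuous (linInterp b) := by
  refine continuous_iff_continuousAt.2 fun s₀ => ?_
  set n := ⌊s₀⌋ with hn
  -- One formula on both sides of the node `n`, valid on `(n-1, n+1)`; it therefore covers integer
  -- `s₀`, where the floor jumps.
  have hlocal : linInterp b =ᶠ[nhds s₀] fun s =>
      b n + (max (s - n) 0 • (b (n + 1) - b n) + min (s - n) 0 • (b n - b (n - 1))) := by
    filter_upwards [Ioo_mem_nhds (a := (n : ℝ) - 1) (b := n + 1)
      (by have := Int.floor_le s₀; rw [← hn] at this; linarith) (Int.lt_floor_add_one s₀)] with s hs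
    rcases le_or_gt (n : ℝ) s with h | h
    · have hf : ⌊s⌋ = n := Int.floor_eq_iff.2 ⟨h, hs.2⟩
      simp [linInterp, Int.fract, hf, max_eq_left (sub_nonneg.2 h), min_eq_right (sub_nonneg.2 h)]
    · have hf : ⌊s⌋ = n - 1 := Int.floor_eq_iff.2
        ⟨by push_cast; exact hs.1.le, by push_cast; linarith⟩
      simp only [linInterp, Int.fract, hf, max_eq_right (sub_nonpos.2 h.le),
        min_eq_left (sub_nonpos.2 h.le), sub_add_cancel]
      push_cast
      module
  refine ContinuousAt.congr ?_ hlocal.symm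
  fun_prop

theorem hasDerivAt_linInterp {s : ℝ} (hs : s ∉ range ((↑) : ℤ → ℝ)) :
    HasDerivAt (linInterp b) (b (⌊s⌋ + 1) - b ⌊s⌋) s := by
  set n := ⌊s⌋ with hn
  have hlt : (n : ℝ) < s := lt_of_le_of_ne (Int.floor_le s) fun h => hs ⟨n, h⟩
  have h1 : HasDerivAt (fun r : ℝ => b n + (r - n) • (b (n + 1) - b n)) (b (n + 1) - b n) s := by
    simpa using (((hasDerivAt_id s).sub_const (n : ℝ)).smul_const (b (n + 1) - b n)).const_add (b n)
  refine h1.congr_of_eventuallyEq ?_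
  filter_upwards [Ioo_mem_nhds hlt (Int.lt_floor_add_one s)] with r hr
  have hf : ⌊r⌋ = n := Int.floor_eq_iff.2 ⟨hr.1.le, hr.2⟩
  simp [linInterp, Int.fract, hf]

theorem enorm_linInterp_sub_le {s : ℝ} {y : X} {M : ℝ≥0∞} (h1 : ‖b ⌊s⌋ - y‖ₑ ≤ M)
    (h2 : ‖b (⌊s⌋ + 1) - y‖ₑ ≤ M) : ‖linInterp b s - y‖ₑ ≤ M := by
  have h0 := Int.fract_nonneg s
  have h0' : 0 ≤ 1 - Int.fract s := sub_nonneg.2 (Int.fract_lt_one s).le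
  have e : linInterp b s - y =
      (1 - Int.fract s) • (b ⌊s⌋ - y) + Int.fract s • (b (⌊s⌋ + 1) - y) := by
    rw [linInterp]; module
  calc ‖linInterp b s - y‖ₑ ≤ ENNReal.ofReal (1 - Int.fract s) * M +
        ENNReal.ofReal (Int.fract s) * M := by
        rw [e]
        refine (enorm_add_le _ _).trans ?_
        rw [enorm_smul, enorm_smul, Real.enorm_of_nonneg h0, Real.enorm_of_nonneg h0']
        gcongr
    _ = M := by rw [← add_mul, ← ENNReal.ofReal_add h0' h0]; simp

/-- The function on `(0,∞)` with value `b n` at `2 ^ n` that is affine in `log t` in between. -/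
def dyadicInterp (b : ℤ → X) (t : ℝ) : X := linInterp b (Real.logb 2 t)

/-- The derivative of `dyadicInterp b` off the powers of `2`. -/
def dyadicSlope (b : ℤ → X) (t : ℝ) : X :=
  (t * Real.log 2)⁻¹ • (b (⌊Real.logb 2 t⌋ + 1) - b ⌊Real.logb 2 t⌋)

theorem continuousOn_dyadicInterp (b : ℤ → X) : ContinuousOn (dyadicInterp b) (Ioi 0) :=
  (continuous_linInterp b).comp_continuousOn
    ((Real.continuousOn_log.mono fun _ ht => (ne_of_gt ht : _ ≠ (0 : ℝ))).div_const _)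

theorem stronglyMeasurable_dyadicSlope (b : ℤ → X) : StronglyMeasurable (dyadicSlope b) := by
  have h1 : StronglyMeasurable fun n : ℤ => b (n + 1) - b n := .of_discrete
  have h2 : Measurable fun t : ℝ => ⌊Real.logb 2 t⌋ :=
    Int.measurable_floor.comp (Real.measurable_log.div_const _)
  have h3 : Measurable fun t : ℝ => (t * Real.log 2)⁻¹ := by fun_prop
  exact h3.stronglyMeasurable.smul (h1.comp_measurable h2)

theorem hasDerivAt_dyadicInterp {t : ℝ} (ht : 0 < t)
    (hs : t ∉ range fun n : ℤ => (2 : ℝ) ^ n) :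
    HasDerivAt (dyadicInterp b) (dyadicSlope b t) t := by
  have h1 : Real.logb 2 t ∉ range ((↑) : ℤ → ℝ) := by
    rintro ⟨n, hn⟩
    refine hs ⟨n, ?_⟩
    change (2 : ℝ) ^ n = t
    rw [← Real.rpow_intCast, hn]
    exact Real.rpow_logb two_pos (by norm_num) ht
  have h2 : HasDerivAt (fun t => Real.logb 2 t) (t * Real.log 2)⁻¹ t := by
    have := (Real.hasDerivAt_log ht.ne').div_const (Real.log 2)
    rwa [div_eq_mul_inv, ← mul_inv] at this
  exact (hasDerivAt_linInterp h1).scomp t h2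

theorem map_dyadicInterp {Y : Type*} [NormedAddCommGroup Y] [NormedSpace ℝ Y] (A : X →L[ℝ] Y)
    (b : ℤ → X) (t : ℝ) : A (dyadicInterp b t) = dyadicInterp (fun n => A (b n)) t := by
  simp [dyadicInterp, linInterp]

theorem dyadicInterp_eq_add_integral [CompleteSpace X] {x : X}
    (hx : Filter.Tendsto (dyadicInterp b) (nhdsWithin 0 (Ioi 0)) (nhds x))
    (hi : ∀ T : ℝ, IntegrableOn (dyadicSlope b) (Ioc 0 T)) {t : ℝ} (ht : 0 < t) :
    dyadicInterp b t = x + ∫ r in (0 : ℝ)..t, dyadicSlope b r := by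
  classical
  -- Assigning the limit `x` at `0` gives continuity on `[0,t]`; the fundamental theorem then
  -- tolerates the countably many kinks at powers of `2`.
  set v : ℝ → X := Function.update (dyadicInterp b) 0 x with hv
  have hv0 : ∀ s, 0 < s → v s = dyadicInterp b s := fun s hs =>
    Function.update_of_ne hs.ne' _ _
  have hcont : ContinuousOn v (Icc 0 t) := by
    intro s hs
    rcases hs.1.eq_or_lt with rfl | hs0
    · refine (continuousWithinAt_update_same.2 (hx.mono_left (nhdsWithin_mono _ ?_)))
      exact fun r hr => lt_of_le_of_ne hr.1.1 (Ne.symm hr.2)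
    · refine ContinuousAt.continuousWithinAt ?_
      refine ((continuousOn_dyadicInterp b).continuousAt (Ioi_mem_nhds hs0)).congr ?_
      filter_upwards [Ioi_mem_nhds hs0] with r hr
      exact (hv0 r hr).symm
  have := integral_eq_of_hasDerivAt_off_countable_of_le v (dyadicSlope b) ht.le
    (countable_range fun n : ℤ => (2 : ℝ) ^ n) hcont (fun s hs => ?_)
    ((intervalIntegrable_iff_integrableOn_Ioc_of_le ht.le).2 (hi t))
  · rw [this, hv0 t ht, hv, Function.update_self, add_sub_cancel]
  · refine (hasDerivAt_dyadicInterp hs.1.1 hs.2).congr_of_eventuallyEq ?_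
    filter_upwards [Ioi_mem_nhds hs.1.1] with r hr
    exact hv0 r hr

end LinInterp

/-! ### Extending elements of the interpolation space. -/

section Extension

variable {X₀ X₁ : Type*} [NormedAddCommGroup X₀] [NormedSpace ℝ X₀]
  [NormedAddCommGroup X₁] [NormedSpace ℝ X₁] {ι : X₁ →L[ℝ] X₀} {p μ : ℝ}

/-- Restrict the norm integral to `(t, 2t]`, where `K(s,x) ≥ K(t,x)` and `s^(-μ) ≥ (2t)^(-μ)`. -/
theorem kFunctional_le_rpow_mul_interpNorm (hp : 0 < p) (hμ : 0 ≤ μ) {t : ℝ} (ht : 0 < t)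
    (x : X₀) : kFunctional ι t x ≤
      ENNReal.ofReal (2 ^ μ * t ^ (μ - 1 / p)) * interpNorm ι (μ - 1 / p) p x := by
  have h1 : ENNReal.ofReal ((2 * t) ^ (-μ)) * kFunctional ι t x * ENNReal.ofReal (t ^ (1 / p)) ≤
      interpNorm ι (μ - 1 / p) p x := by
    rw [interpNorm_eq hp]
    calc _ = (∫⁻ _ in Ioc t (2 * t),
          (ENNReal.ofReal ((2 * t) ^ (-μ)) * kFunctional ι t x) ^ p) ^ (1 / p) := by
          rw [setLIntegral_const, Real.volume_Ioc, ENNReal.mul_rpow_of_nonneg _ _ (by positivity),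
            ← ENNReal.rpow_mul, mul_one_div_cancel hp.ne', ENNReal.rpow_one,
            ENNReal.ofReal_rpow_of_nonneg (by linarith) (by positivity)]
          congr 4
          ring
      _ ≤ (∫⁻ s in Ioc t (2 * t),
          (ENNReal.ofReal (s ^ (-μ)) * kFunctional ι s x) ^ p) ^ (1 / p) := by
          gcongr ?_ ^ _
          refine setLIntegral_mono' measurableSet_Ioc fun s hs => ?_
          refine ENNReal.rpow_le_rpow (mul_le_mul' (ENNReal.ofReal_le_ofReal ?_) ?_) hp.le
          · exact Real.rpow_le_rpow_of_nonpos (ht.trans hs.1) hs.2 (by linarith)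
          · exact kFunctional_mono x hs.1.le
      _ ≤ _ := by
          gcongr ?_ ^ _
          exact lintegral_mono_set fun s hs => ht.trans hs.1
  calc kFunctional ι t x = ENNReal.ofReal (2 ^ μ * t ^ (μ - 1 / p)) *
        (ENNReal.ofReal ((2 * t) ^ (-μ)) * kFunctional ι t x * ENNReal.ofReal (t ^ (1 / p))) := by
        rw [mul_right_comm, ← ENNReal.ofReal_mul (by positivity), ← mul_assoc,
          ← ENNReal.ofReal_mul (by positivity), Real.mul_rpow two_pos.le ht.le]
        have : 2 ^ μ * t ^ (μ - 1 / p) * (2 ^ (-μ) * t ^ (-μ) * t ^ (1 / p)) = 1 := by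
          calc _ = (2 ^ μ * 2 ^ (-μ)) * (t ^ (μ - 1 / p) * t ^ (-μ) * t ^ (1 / p)) := by ring
            _ = 1 := by
              rw [← Real.rpow_add two_pos, ← Real.rpow_add ht, ← Real.rpow_add ht]
              ring_nf
              simp
        rw [this]
        simp
    _ ≤ _ := by gcongr

theorem tendsto_kFunctional_zero (hp : 0 < p) (hμ : 1 / p < μ) {x : X₀}
    (hx : x ∈ interpSpace ι (μ - 1 / p) p) :
    Filter.Tendsto (fun t => kFunctional ι t x) (nhdsWithin 0 (Ioi 0)) (nhds 0) := by
  have hx : interpNorm ι (μ - 1 / p) p x < ⊤ := hx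
  have hμ0 : 0 ≤ μ := le_trans (by positivity) hμ.le
  have h1 : Filter.Tendsto (fun t : ℝ => ENNReal.ofReal (2 ^ μ * t ^ (μ - 1 / p)) *
      interpNorm ι (μ - 1 / p) p x) (nhdsWithin 0 (Ioi 0)) (nhds 0) := by
    have h2 : Continuous fun t : ℝ => 2 ^ μ * t ^ (μ - 1 / p) :=
      continuous_const.mul (Real.continuous_rpow_const (by linarith))
    have h3 := ENNReal.Tendsto.mul_const
      ((ENNReal.continuous_ofReal.comp h2).tendsto 0) (Or.inr hx.ne)
    simp only [Function.comp, Real.zero_rpow (show μ - 1 / p ≠ 0 by linarith), mul_zero,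
      ENNReal.ofReal_zero, zero_mul] at h3
    exact h3.mono_left nhdsWithin_le_nhds
  refine tendsto_of_tendsto_of_tendsto_of_le_of_le' tendsto_const_nhds h1
    (Filter.Eventually.of_forall fun _ => zero_le) ?_
  filter_upwards [self_mem_nhdsWithin] with t ht
  exact kFunctional_le_rpow_mul_interpNorm hp hμ0 ht x

theorem wLpNorm_le_mul_interpNorm {Y : Type*} [NormedAddCommGroup Y] [NormedSpace ℝ Y]
    {f : ℝ → Y} (hp : 0 < p) {x : X₀} {c : ℝ≥0}
    (hf : ∀ t, 0 < t → ‖f t‖ₑ ≤ c * (ENNReal.ofReal t⁻¹ * kFunctional ι t x)) :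
    wLpNorm p μ f ≤ c * interpNorm ι (μ - 1 / p) p x := by
  rw [interpNorm_eq hp, ← const_mul_Lp hp]
  refine (wLpNorm_le_of_enorm_le hp ((ae_restrict_iff' measurableSet_Ioi).2
    (Filter.Eventually.of_forall hf))).trans ?_
  gcongr ?_ ^ _
  refine setLIntegral_mono' measurableSet_Ioi fun t ht => ?_
  have ht : 0 < t := ht
  refine le_of_eq ?_
  rw [mul_left_comm, ← mul_assoc (ENNReal.ofReal (t ^ (1 - μ))),
    ← ENNReal.ofReal_mul (by positivity), ← Real.rpow_neg_one, ← Real.rpow_add ht]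
  congr 5
  ring

/-- Bounds for a sequence of almost minimizers at the points `2 ^ n` near `t`. -/
theorem almost_minimizer_bounds {x : X₀} {b : ℤ → X₁}
    (hb : ∀ n : ℤ, ‖x - ι (b n)‖ₑ + ENNReal.ofReal (2 ^ n) * ‖b n‖ₑ ≤ 2 * kFunctional ι (2 ^ n) x)
    {t : ℝ} (ht : 0 < t) {m : ℤ} (hm : m = ⌊Real.logb 2 t⌋ ∨ m = ⌊Real.logb 2 t⌋ + 1) :
    ‖ι (b m) - x‖ₑ ≤ 4 * kFunctional ι t x ∧
      ‖b m‖ₑ ≤ 4 * (ENNReal.ofReal t⁻¹ * kFunctional ι t x) := by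
  set n := ⌊Real.logb 2 t⌋
  have hlog : (2 : ℝ) ^ Real.logb 2 t = t := Real.rpow_logb two_pos (by norm_num) ht
  have hn1 : (2 : ℝ) ^ n ≤ t := by
    conv_rhs => rw [← hlog]
    rw [← Real.rpow_intCast]
    exact Real.rpow_le_rpow_of_exponent_le one_le_two (Int.floor_le _)
  have hn2 : t ≤ (2 : ℝ) ^ (n + 1) := by
    conv_lhs => rw [← hlog]
    rw [← Real.rpow_intCast]
    refine Real.rpow_le_rpow_of_exponent_le one_le_two ?_
    push_cast
    exact (Int.lt_floor_add_one _).le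
  have h2n : (2 : ℝ) ^ (n + 1) = 2 * 2 ^ n := by rw [zpow_add_one₀ two_ne_zero, mul_comm]
  have hinv : ∀ y : ℝ≥0∞, y = ENNReal.ofReal t⁻¹ * (ENNReal.ofReal t * y) := fun y => by
    rw [← mul_assoc, ← ENNReal.ofReal_mul (by positivity), inv_mul_cancel₀ ht.ne']
    simp
  suffices h : ‖x - ι (b m)‖ₑ ≤ 4 * kFunctional ι t x ∧
      ENNReal.ofReal t * ‖b m‖ₑ ≤ 4 * kFunctional ι t x by
    refine ⟨by rw [← enorm_neg, neg_sub]; exact h.1, ?_⟩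
    rw [hinv ‖b m‖ₑ, mul_left_comm 4]
    exact mul_le_mul' le_rfl h.2
  have e4 : (4 : ℝ≥0∞) = 2 * 2 := by norm_num
  -- At the left node one factor `2` is near-minimality and the other is `t ≤ 2·2^n`. At the right
  -- node the second comes from `K(2^(n+1),x) ≤ K(2t,x) ≤ 2K(t,x)`.
  rcases hm with rfl | rfl
  · have hK : 2 * kFunctional ι (2 ^ n) x ≤ 2 * kFunctional ι t x := by
      gcongr
      exact kFunctional_mono x hn1
    have h := (hb n).trans hK
    refine ⟨le_self_add.trans (h.trans ?_), ?_⟩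
    · gcongr
      norm_num
    · calc ENNReal.ofReal t * ‖b n‖ₑ ≤ ENNReal.ofReal (2 * 2 ^ n) * ‖b n‖ₑ := by
            gcongr
            linarith
        _ = 2 * (ENNReal.ofReal (2 ^ n) * ‖b n‖ₑ) := by
            rw [ENNReal.ofReal_mul two_pos.le, ENNReal.ofReal_ofNat, mul_assoc]
        _ ≤ 2 * (2 * kFunctional ι t x) := by
            exact mul_le_mul' le_rfl (le_add_self.trans h)
        _ = _ := by rw [e4, mul_assoc]
  · have hK : 2 * kFunctional ι (2 ^ (n + 1)) x ≤ 4 * kFunctional ι t x := by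
      rw [e4, mul_assoc]
      gcongr
      refine le_trans (kFunctional_mono x ?_) (kFunctional_two_mul_le t x)
      simp only [h2n]
      linarith
    have h := (hb (n + 1)).trans hK
    refine ⟨le_self_add.trans h, le_trans ?_ (le_add_self.trans h)⟩
    gcongr

variable [CompleteSpace X₀]

theorem memE_of_primitive {u : ℝ → X₁} {w : ℝ → X₀} {x : X₀} (hp : 1 < p) (hμ : 1 / p < μ)
    (hu : MemWLp p μ u) (hιu : MemWLp p μ fun t => ι (u t)) (hw : MemWLp p μ w)
    (h : (fun t => ι (u t)) =ᵐ[volume.restrict (Ioi 0)] fun t => x + ∫ r in (0 : ℝ)..t, w r) :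
    MemE ι p μ u ∧ IsTrace (fun t => ι (u t)) x ∧
      eNorm ι p μ u ≤ wLpNorm p μ (fun t => ι (u t)) + wLpNorm p μ w + wLpNorm p μ u := by
  have hwi : ∀ T : ℝ, IntegrableOn w (Ioc 0 T) := fun T => hw.integrableOn_Ioc hp hμ T
  have hd : HasWeakDeriv (fun t => ι (u t)) w := (hasWeakDeriv_primitive x hwi).congr_ae h.symm
  have hloc : MemW1loc (fun t => ι (u t)) := ⟨w, hd⟩
  have hae : weakDeriv (fun t => ι (u t)) =ᵐ[volume.restrict (Ioi 0)] w :=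
    hloc.hasWeakDeriv.ae_unique hd
  have hnorm : wLpNorm p μ (weakDeriv fun t => ι (u t)) = wLpNorm p μ w := wLpNorm_congr_ae hae
  refine ⟨⟨hu, hιu, hloc, memWLp_of_wLpNorm_lt_top (hw.aestronglyMeasurable.congr hae.symm) ?_⟩,
    ⟨_, h.symm, continuousOn_primitive_Ici x hwi, by simp⟩, ?_⟩
  · rw [hnorm]
    exact hw.wLpNorm_lt_top
  · rw [eNorm, wNorm, hnorm]
    gcongr
    exact ENNReal.rpow_add_rpow_le_add _ _ hp.le

/-- Elements of the interpolation space are traces of elements of `𝔼_{1,μ}`. -/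
theorem exists_memE_isTrace (ι : X₁ →L[ℝ] X₀) (hp : 1 < p) (hμ : 1 / p < μ) :
    ∃ C : ℝ≥0, ∀ x ∈ interpSpace ι (μ - 1 / p) p, ∃ u : ℝ → X₁, MemE ι p μ u ∧
      IsTrace (fun t => ι (u t)) x ∧ eNorm ι p μ u ≤ C * interpNorm ι (μ - 1 / p) p x := by
  have hp0 : 0 < p := by linarith
  -- The summands bound `ι ∘ u`, its derivative and `u`. The `16` is `2 · (4 + 4)`: `1/log 2 ≤ 2`,
  -- times two node errors.
  refine ⟨‖ι‖₊ * 4 + 16 + 4, fun x hx => ?_⟩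
  have hxt : interpNorm ι (μ - 1 / p) p x < ⊤ := hx
  choose b hb using fun n : ℤ => exists_almost_minimizer (ι := ι)
    (zpow_pos two_pos n : (0 : ℝ) < 2 ^ n) x
  set u := dyadicInterp b
  set w := dyadicSlope fun n => ι (b n)
  have hum : AEStronglyMeasurable u (volume.restrict (Ioi 0)) :=
    (continuousOn_dyadicInterp b).aestronglyMeasurable measurableSet_Ioi
  have hu : ∀ t, 0 < t → ‖u t‖ₑ ≤ (4 : ℝ≥0) * (ENNReal.ofReal t⁻¹ * kFunctional ι t x) := by
    intro t ht
    have h1 := (almost_minimizer_bounds hb ht (Or.inl rfl)).2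
    have h2 := (almost_minimizer_bounds hb ht (Or.inr rfl)).2
    have := enorm_linInterp_sub_le (y := (0 : X₁)) (by simpa using h1) (by simpa using h2)
    simpa [u, dyadicInterp] using this
  have hιu : ∀ t, 0 < t →
      ‖ι (u t)‖ₑ ≤ (‖ι‖₊ * 4 : ℝ≥0) * (ENNReal.ofReal t⁻¹ * kFunctional ι t x) := by
    intro t ht
    refine (ι.le_opENorm (u t)).trans ?_
    rw [ENNReal.coe_mul, mul_assoc]
    gcongr
    · exact le_rfl
    · exact hu t ht
  have hw : ∀ t, 0 < t → ‖w t‖ₑ ≤ (16 : ℝ≥0) * (ENNReal.ofReal t⁻¹ * kFunctional ι t x) := by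
    intro t ht
    have h1 := (almost_minimizer_bounds hb ht (Or.inl rfl)).1
    have h2 := (almost_minimizer_bounds hb ht (Or.inr rfl)).1
    have hlog : (1 / 2 : ℝ) ≤ Real.log 2 := by linarith [Real.log_two_gt_d9]
    have hle : (t * Real.log 2)⁻¹ ≤ 2 * t⁻¹ := by
      rw [mul_inv, mul_comm]
      gcongr
      exact inv_le_of_inv_le₀ two_pos (by linarith)
    calc ‖w t‖ₑ = ENNReal.ofReal (t * Real.log 2)⁻¹ *
          ‖(ι (b (⌊Real.logb 2 t⌋ + 1)) - x) - (ι (b ⌊Real.logb 2 t⌋) - x)‖ₑ := by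
          simp only [w, dyadicSlope]
          rw [enorm_smul, Real.enorm_of_nonneg (by positivity), sub_sub_sub_cancel_right]
      _ ≤ ENNReal.ofReal (2 * t⁻¹) * (4 * kFunctional ι t x + 4 * kFunctional ι t x) := by
          gcongr
          exact (enorm_sub_le).trans (add_le_add h2 h1)
      _ = _ := by
          rw [ENNReal.ofReal_mul two_pos.le, ENNReal.ofReal_ofNat, ENNReal.coe_ofNat]
          ring
  have hlim : Filter.Tendsto (dyadicInterp fun n => ι (b n)) (nhdsWithin 0 (Ioi 0)) (nhds x) := by
    rw [tendsto_iff_enorm_sub_tendsto_zero]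
    have h0 := ENNReal.Tendsto.const_mul (a := 4) (tendsto_kFunctional_zero hp0 hμ hx)
      (Or.inr ENNReal.ofNat_ne_top)
    rw [mul_zero] at h0
    refine tendsto_of_tendsto_of_tendsto_of_le_of_le' tendsto_const_nhds h0
      (Filter.Eventually.of_forall fun _ => zero_le) ?_
    filter_upwards [self_mem_nhdsWithin] with t ht
    exact enorm_linInterp_sub_le (almost_minimizer_bounds hb ht (Or.inl rfl)).1
      (almost_minimizer_bounds hb ht (Or.inr rfl)).1
  have nu := wLpNorm_le_mul_interpNorm (μ := μ) hp0 hu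
  have nιu := wLpNorm_le_mul_interpNorm (μ := μ) hp0 hιu
  have nw := wLpNorm_le_mul_interpNorm (μ := μ) hp0 hw
  have hfin : ∀ c : ℝ≥0, c * interpNorm ι (μ - 1 / p) p x < ⊤ := fun c =>
    ENNReal.mul_lt_top ENNReal.coe_lt_top hxt
  have mw : MemWLp p μ w := memWLp_of_wLpNorm_lt_top
    (stronglyMeasurable_dyadicSlope _).aestronglyMeasurable (nw.trans_lt (hfin _))
  obtain ⟨h1, h2, h3⟩ := memE_of_primitive (x := x) hp hμ
    (memWLp_of_wLpNorm_lt_top hum (nu.trans_lt (hfin _)))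
    (memWLp_of_wLpNorm_lt_top (ι.continuous.comp_aestronglyMeasurable hum)
      (nιu.trans_lt (hfin _))) mw (by
      filter_upwards [ae_restrict_mem measurableSet_Ioi] with t ht
      rw [map_dyadicInterp]
      exact dyadicInterp_eq_add_integral hlim (fun T => mw.integrableOn_Ioc hp hμ T) ht)
  refine ⟨u, h1, h2, h3.trans ?_⟩
  rw [ENNReal.coe_add, ENNReal.coe_add, add_mul, add_mul]
  gcongr

end Extension

end TimeWeight

end

theorem mainTheorem2 {X₀ X₁ : Type*}
    [NormedAddCommGroup X₀] [NormedSpace ℝ X₀] [CompleteSpace X₀]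
    [NormedAddCommGroup X₁] [NormedSpace ℝ X₁] [CompleteSpace X₁]
    (ι : X₁ →L[ℝ] X₀) (hι : Function.Injective ι) (hdense : DenseRange ι)
    (p μ : ℝ) (hp : 1 < p) (hμ : 1 / p < μ) (hμ1 : μ ≤ 1) :
    (TimeWeight.traceSpace ι p μ = TimeWeight.interpSpace ι (μ - 1 / p) p ∧
      ∃ c C : ℝ≥0, 0 < c ∧ 0 < C ∧ ∀ x ∈ TimeWeight.interpSpace ι (μ - 1 / p) p,
        c * TimeWeight.interpNorm ι (μ - 1 / p) p x ≤ TimeWeight.traceNorm ι p μ x ∧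
        TimeWeight.traceNorm ι p μ x ≤ C * TimeWeight.interpNorm ι (μ - 1 / p) p x) ∧
    (∃ C : ℝ≥0, ∀ u : ℝ → X₁, TimeWeight.MemE ι p μ u →
      ∃ v : ℝ → X₀, v =ᵐ[volume.restrict (Ioi 0)] (fun t => ι (u t)) ∧
        TimeWeight.IsBUC ι (μ - 1 / p) p v ∧
        TimeWeight.bucNorm ι (μ - 1 / p) p v ≤ C * TimeWeight.eNorm ι p μ u) := by
  obtain ⟨A, hA⟩ := TimeWeight.exists_interpNorm_le_traceNorm ι hp hμ hμ1
  obtain ⟨B, hB⟩ := TimeWeight.exists_memE_isTrace ι hp hμ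
  -- Adding `1` keeps both constants positive and the inverse meaningful, since `A` and `B` may be
  -- zero.
  refine ⟨⟨?_, (A + 1)⁻¹, B + 1, by positivity, by positivity, fun x hx => ⟨?_, ?_⟩⟩,
    TimeWeight.exists_isBUC_bucNorm_le ι hp hμ hμ1⟩
  · ext x
    constructor
    · rintro ⟨u, hu, hx⟩
      exact (hA u x hu hx).trans_lt
        (ENNReal.mul_lt_top ENNReal.coe_lt_top (hu.eNorm_lt_top (by linarith)))
    · intro hx
      obtain ⟨u, hu, hx, -⟩ := hB x hx
      exact ⟨u, hu, hx⟩
  · refine le_iInf fun u => le_iInf fun hu => le_iInf fun hx => ?_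
    rw [ENNReal.coe_inv (by positivity), ENNReal.inv_mul_le_iff (by simp) ENNReal.coe_ne_top]
    refine (hA u x hu hx).trans ?_
    gcongr
    simp
  · obtain ⟨u, hu, hx, hle⟩ := hB x hx
    have hux : TimeWeight.traceNorm ι p μ x ≤ TimeWeight.eNorm ι p μ u :=
      iInf_le_of_le u (iInf_le_of_le hu (iInf_le _ hx))
    refine hux.trans (hle.trans ?_)
    gcongr
    simp
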